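/- Call $n$ composite if $n>1$ is an integer that is not prime. For monic $g\in(\mathbb Z/n\mathbb Z)[x]$, write $g={\rm gcmd}(g_1,g_2)$ if $g_1,g_2$ generate the same ideal of $(\mathbb Z/n\mathbb Z)[x]$ as $g$; such a $g$ is unique if it exists. Let $f\in\mathbb Z[x]$ be monic of degree $2$ with discriminant $\Delta$, and let $n$ be composite. Then $f$ is a degree-$2$ Frobenius liar with respect to $n$ if: 1. $\gcd(n,f(0)\Delta)=1$; 2. modulo $n$, the polynomials $F_1={\rm gcmd}(x^n-x,f)$, $f_1=f/F_1$, $F_2={\rm gcmd}(x^{n^2}-x,f_1)$, $f_2=f_1/F_2$ all exist, and $f_2=1$; 3. $F_2(x)\mid F_2(x^n)$ modulo $n$; 4. $S=\deg(F_2)/2$ is an integer and $(-1)^S=\left(\frac{\Delta}{n}\right)$, where $\left(\frac{\cdot}{n}\right)$ is the Jacobi symbol, extended to even $n$ as the Kronecker symbol, i.e. $\left(\frac{a}{2}\right)=0,1,-1$ according as $a$ is even, $a\equiv\pm1$, or $a\equiv\pm3 \pmod 8$. Let $L_2(n)$ be the number of polynomials in $(\mathbb Z/n\mathbb Z)[x]$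 that are reductions modulo $n$ of degree-$2$ Frobenius liars with respect to $n$, and let $$\mathcal L(x)=\exp\left(\frac{\log x\,\log\log\log x}{\log\log x}\right),$$ where $\log$ is the natural logarithm. **Theorem.** There is a function $o(1)$ of the real variable $x$, tending to $0$ as $x\to\infty$, such that for all sufficiently large $x$ $$\sum_{\substack{n\le x\\ n\text{ composite}}} L_2(n)\ \le\ x^3\,\mathcal L(x)^{-1+o(1)}.$$ -/

import Mathlib

open Polynomial Filter Topology

namespace FrobeniusLiars

/-- The Jacobi symbol `(a / n)` of an integer `a` over a positive integer `n`, extended to even `n`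
in the usual way by `(a / 2) = 0, 1, -1` according as `a` is even, `a ≡ ±1 (mod 8)`,
`a ≡ ±3 (mod 8)` (Kronecker symbol). For odd `n` it is the ordinary Jacobi symbol. -/
def jacobiKronecker (a : ℤ) (n : ℕ) : ℤ :=
  ZMod.χ₈ (a : ZMod 8) ^ n.factorization 2 * jacobiSym a (n / 2 ^ n.factorization 2)

theorem jacobiKronecker_of_odd (a : ℤ) {n : ℕ} (hn : Odd n) :
    jacobiKronecker a n = jacobiSym a n := by
  have h : n.factorization 2 = 0 :=
    Nat.factorization_eq_zero_of_not_dvd hn.not_two_dvd_nat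
  simp [jacobiKronecker, h]

/-- `g` is the greatest common monic divisor of `g₁` and `g₂`: it is monic and generates the same
ideal as `g₁, g₂`. It need not exist over a general ring, but is unique if it does. -/
def IsGcmd {R : Type*} [CommRing R] (g₁ g₂ g : R[X]) : Prop :=
  g.Monic ∧ Ideal.span {g₁, g₂} = Ideal.span {g}

theorem IsGcmd.unique {R : Type*} [CommRing R] {g₁ g₂ g h : R[X]}
    (hg : IsGcmd g₁ g₂ g) (hh : IsGcmd g₁ g₂ h) : g = h := by
  have e : Ideal.span {g} = Ideal.span {h} := hg.2.symm.trans hh.2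
  have h1 : h ∣ g := Ideal.span_singleton_le_span_singleton.mp e.le
  have h2 : g ∣ h := Ideal.span_singleton_le_span_singleton.mp e.ge
  nontriviality R
  refine eq_of_monic_of_dvd_of_natDegree_le hh.1 hg.1 h1 ?_
  obtain ⟨c, rfl⟩ := h2
  have hc : c ≠ 0 := by
    rintro rfl
    exact hh.1.ne_zero (by simp)
  rw [hg.1.natDegree_mul' hc]
  exact Nat.le_add_right _ _

/-- A natural number is composite if it is greater than `1` and not prime. -/
def IsComposite (n : ℕ) : Prop := 1 < n ∧ ¬ n.Prime

instance : DecidablePred IsComposite := fun n =>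
  inferInstanceAs (Decidable (1 < n ∧ ¬ n.Prime))

/-- `n` is a degree-2 Frobenius pseudoprime with respect to `f ∈ ℤ[x]`, equivalently, `f` is a
degree-2 Frobenius liar with respect to `n`. The polynomials `F₁, f₁, F₂, f₂` live in
`(ℤ/nℤ)[x]`; the quotients `f₁ = f / F₁`, `f₂ = f₁ / F₂` are exact. -/
structure IsFrobeniusLiar (f : ℤ[X]) (n : ℕ) : Prop where
  composite : IsComposite n
  monic : f.Monic
  natDegree_eq : f.natDegree = 2
  /-- Integer divisibility. -/
  gcd_eq_one : Int.gcd (n : ℤ) (f.eval 0 * f.discr) = 1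
  /-- Factorization, Frobenius and Jacobi steps. -/
  steps : ∃ F₁ f₁ F₂ f₂ : (ZMod n)[X],
    IsGcmd (X ^ n - X) (f.map (Int.castRingHom (ZMod n))) F₁ ∧
    f.map (Int.castRingHom (ZMod n)) = F₁ * f₁ ∧
    IsGcmd (X ^ (n ^ 2) - X) f₁ F₂ ∧
    f₁ = F₂ * f₂ ∧
    f₂ = 1 ∧
    F₂ ∣ F₂.comp (X ^ n) ∧
    ∃ S : ℕ, F₂.natDegree = 2 * S ∧ (-1 : ℤ) ^ S = jacobiKronecker f.discr n

/-- The set of degree-2 Frobenius liars modulo `n`, as quadratic polynomials over `ℤ/nℤ`. -/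
def liarSet (n : ℕ) : Set (ZMod n)[X] :=
  {g | ∃ f : ℤ[X], IsFrobeniusLiar f n ∧ f.map (Int.castRingHom (ZMod n)) = g}

/-- `L₂(n)`: the number of degree-2 Frobenius liars modulo `n`. -/
noncomputable def L₂ (n : ℕ) : ℕ := (liarSet n).ncard

/-- There are only finitely many liars modulo `n`, so `L₂ n` is their true number. -/
theorem liarSet_finite (n : ℕ) : (liarSet n).Finite := by
  rcases Nat.eq_zero_or_pos n with rfl | hn
  · refine Set.Finite.subset Set.finite_empty ?_
    rintro g ⟨f, hf, -⟩
    exact absurd hf.composite.1 (by norm_num)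
  · have : NeZero n := ⟨hn.ne'⟩
    refine Set.Finite.of_finite_image (f := fun g : (ZMod n)[X] => (g.coeff 0, g.coeff 1))
      (Set.toFinite _) ?_
    have key : ∀ g ∈ liarSet n, g = X ^ 2 + C (g.coeff 1) * X + C (g.coeff 0) := by
      rintro g ⟨f, hf, rfl⟩
      have h2 : f.coeff 2 = 1 := by
        have h := hf.monic.coeff_natDegree
        rwa [hf.natDegree_eq] at h
      have hq : f = X ^ 2 + C (f.coeff 1) * X + C (f.coeff 0) := by
        conv_lhs => rw [f.as_sum_range_C_mul_X_pow, hf.natDegree_eq]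
        simp only [Finset.sum_range_succ, Finset.sum_range_zero, h2]
        simp only [pow_zero, pow_one, map_one]
        ring
      conv_lhs => rw [hq]
      simp [Polynomial.coeff_map]
    intro g hg h hh e
    simp only [Prod.mk.injEq] at e
    rw [key g hg, key h hh, e.1, e.2]

/-- `𝓛(x) = exp (log x · log log log x / log log x)`. -/
noncomputable def scriptL (x : ℝ) : ℝ :=
  Real.exp (Real.log x * Real.log (Real.log (Real.log x)) / Real.log (Real.log x))

end FrobeniusLiars

namespace FrobeniusLiars

/-! A liar `x² + ax + b` modulo `n` must have `b ^ (n - 1) = 1`: the `n`-th power map either fixes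
both roots or swaps them, so it fixes their product `b`. Leaving `a` free gives `L₂ n ≤ n *
rootCount n (n - 1)`, and it remains to bound the number of Fermat liars on average over composite
`n ≤ N = ⌊x⌋`, in the style of Erdős and Pomerance.

Take `P = ⌈𝓛(x)⌉`. The `n ≤ N / P` contribute trivially little. If a prime `p > P` divides `n = pm`,
the `p`-part admits at most `gcd(p - 1, m - 1)` roots, which is small on average
(`sum_rootCount_largePrime_le`). Every other `n` is `P`-smooth and has a divisor `d` in `(N / P², N
/ P]`. Writing `n = dm` and sorting the residues modulo `d` by their order `r`, the condition `r ∣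
dm - 1` confines `m` to one class modulo `r`; this leaves sums of `rootCount d r / d²` over `d > N /
P²` (`sum_rootCount_smooth_le`).

Rankin's trick and an Euler product bound these sums (`sum_rootCount_div_sq_le`) in terms of `∑ p ^
(-c)` over primes `p ∣ r`. With `1 - c` slightly below `log log log x / log log x` that sum is
`o(log log x)`, so the Euler product costs only `𝓛(x) ^ o(1)`, while Rankin's factor saves nearly
`𝓛(x)`. -/

/-- The number of solutions of `b ^ r = 1` in `ℤ/dℤ`. -/
noncomputable def rootCount (d r : ℕ) : ℕ := {b : ZMod d | b ^ r = 1}.ncard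

/-! ### From liars to roots of unity -/

/-- If a monic quadratic `f` over `R` passes the degree-2 Frobenius test to the exponent `n`, its
constant coefficient is fixed by the `n`-th power map. -/
theorem coeff_zero_pow_eq_of_frobenius_steps {R : Type*} [CommRing R] [Nontrivial R] {n : ℕ}
    {a b : R} {F₁ F₂ : R[X]} (hf : X ^ 2 + C a * X + C b = F₁ * F₂)
    (h₁ : IsGcmd (X ^ n - X) (X ^ 2 + C a * X + C b) F₁) (h₂ : F₂.Monic)
    (hF : F₂ ∣ F₂.comp (X ^ n)) (heven : Even F₂.natDegree) : b ^ n = b := by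
  set f : R[X] := X ^ 2 + C a * X + C b with hfdef
  have hfm : f.Monic := by rw [hf]; exact h₁.1.mul h₂
  have hdeg : f.natDegree = 2 := by rw [hfdef]; compute_degree!
  have hsum : F₁.natDegree + F₂.natDegree = 2 := by rw [← h₁.1.natDegree_mul h₂, ← hf, hdeg]
  let A := AdjoinRoot f
  let φ : R →+* A := AdjoinRoot.of f
  have hinj : Function.Injective φ := by
    rw [injective_iff_map_eq_zero]
    intro r hr
    by_contra h
    exact hfm.not_dvd_of_natDegree_lt (C_ne_zero.mpr h) (by rw [natDegree_C, hdeg]; norm_num)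
      (AdjoinRoot.mk_eq_zero.mp hr)
  let x : A := AdjoinRoot.root f
  let y : A := -φ a - x
  have hx : x ^ 2 + φ a * x + φ b = 0 := by
    have := AdjoinRoot.eval₂_root f
    simpa [hfdef, eval₂_add, eval₂_mul] using this
  have hxy : x * y = φ b := by linear_combination -hx
  have hy : y ^ 2 + φ a * y + φ b = 0 := by
    linear_combination (exp := 1) hx
  have hfx : f.eval₂ φ x = 0 := by simpa [hfdef, eval₂_add, eval₂_mul] using hx
  have hfy : f.eval₂ φ y = 0 := by simpa [hfdef, eval₂_add, eval₂_mul] using hy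
  apply hinj
  rw [map_pow, ← hxy, mul_pow]
  obtain ⟨S, hS⟩ := heven
  -- Evenness excludes degree 1, so either `F₁ = f` (the power map fixes both roots) or `F₂ = f` (it
  -- swaps them).
  obtain h0 | h0 : F₂.natDegree = 0 ∨ F₁.natDegree = 0 := by omega
  · have hF2 : F₂ = 1 := h₂.natDegree_eq_zero.mp h0
    have hff : f = F₁ := by rw [hf, hF2, mul_one]
    have hd : f ∣ X ^ n - X := by
      rw [← Ideal.mem_span_singleton, hff, ← h₁.2]
      exact Ideal.subset_span (by simp)
    have key : ∀ z : A, f.eval₂ φ z = 0 → z ^ n = z := by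
      intro z hz
      have := eval₂_dvd φ z hd
      rw [hz, zero_dvd_iff] at this
      simpa [sub_eq_zero] using this
    rw [key x hfx, key y hfy]
  · have hF1 : F₁ = 1 := h₁.1.natDegree_eq_zero.mp h0
    have hff : f = F₂ := by rw [hf, hF1, one_mul]
    obtain ⟨u, v, huv⟩ := Ideal.mem_span_pair.mp
      (show (1 : R[X]) ∈ Ideal.span {X ^ n - X, f} by
        rw [h₁.2, hF1]; exact Ideal.mem_span_singleton_self 1)
    -- `A` may have zero divisors, but `z ^ n - z` is a unit by the gcmd condition, so it cancels
    -- from `0 = f(z ^ n) = (z ^ n - z)(z ^ n - w)`.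
    have key : ∀ z w : A, z + w = - φ a → f.eval₂ φ z = 0 → z ^ n = w := by
      intro z w hzw hz
      have h1 : u.eval₂ φ z * (z ^ n - z) = 1 := by
        have := congrArg (eval₂ φ z) huv
        simpa [eval₂_add, eval₂_mul, hz] using this
      have h2 : f.eval₂ φ (z ^ n) = 0 := by
        rw [← hff] at hF
        have := eval₂_dvd φ z hF
        rw [hz, zero_dvd_iff, eval₂_comp] at this
        simpa using this
      have h3 : (z ^ n) ^ 2 + φ a * z ^ n + φ b = 0 := by
        simpa [hfdef, eval₂_add, eval₂_mul] using h2
      have h4 : z ^ 2 + φ a * z + φ b = 0 := by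
        simpa [hfdef, eval₂_add, eval₂_mul] using hz
      have h5 : (z ^ n - z) * (z ^ n - w) = 0 := by
        linear_combination h3 - h4 + (z - z ^ n) * hzw
      linear_combination u.eval₂ φ z * h5 - (z ^ n - w) * h1
    rw [key x y (by ring) hfx, key y x (by ring) hfy, mul_comm]

theorem IsFrobeniusLiar.coeff_zero_pow {f : ℤ[X]} {n : ℕ} (hf : IsFrobeniusLiar f n) :
    ((f.coeff 0 : ℤ) : ZMod n) ^ (n - 1) = 1 := by
  have hn : 1 < n := hf.composite.1
  have : Fact (1 < n) := ⟨hn⟩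
  obtain ⟨F₁, f₁, F₂, f₂, h1, h2, h3, h4, h5, h6, S, h7, -⟩ := hf.steps
  have hc2 : f.coeff 2 = 1 := by
    have h := hf.monic.coeff_natDegree
    rwa [hf.natDegree_eq] at h
  have hq : f = X ^ 2 + C (f.coeff 1) * X + C (f.coeff 0) := by
    conv_lhs => rw [f.as_sum_range_C_mul_X_pow, hf.natDegree_eq]
    simp only [Finset.sum_range_succ, Finset.sum_range_zero, hc2]
    simp only [pow_zero, pow_one, map_one]
    ring
  have hmap : f.map (Int.castRingHom (ZMod n)) =
      X ^ 2 + C ((f.coeff 1 : ℤ) : ZMod n) * X + C ((f.coeff 0 : ℤ) : ZMod n) := by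
    conv_lhs => rw [hq]
    simp
  rw [hmap] at h1 h2
  rw [h5, mul_one] at h4
  subst h4
  have key := coeff_zero_pow_eq_of_frobenius_steps h2 h1 h3.1 h6 ⟨S, by omega⟩
  have hu : IsUnit ((f.coeff 0 : ℤ) : ZMod n) := by
    have hg : IsCoprime (n : ℤ) (f.coeff 0) := by
      have := Int.isCoprime_iff_gcd_eq_one.mpr hf.gcd_eq_one
      rw [← coeff_zero_eq_eval_zero] at this
      exact this.of_mul_right_left
    exact (ZMod.coe_int_isUnit_iff_isCoprime _ _).mpr hg
  obtain ⟨m, rfl⟩ : ∃ m, n = m + 1 := ⟨n - 1, by omega⟩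
  rw [pow_succ] at key
  simpa using hu.mul_right_cancel (key.trans (one_mul _).symm)

theorem L₂_le (n : ℕ) (hn : 0 < n) : L₂ n ≤ n * rootCount n (n - 1) := by
  have : NeZero n := ⟨hn.ne'⟩
  have hcard : (Set.univ ×ˢ {b : ZMod n | b ^ (n - 1) = 1} : Set (ZMod n × ZMod n)).ncard
      = n * rootCount n (n - 1) := by
    rw [Set.ncard_prod, Set.ncard_univ, Nat.card_zmod, rootCount]
  rw [← hcard]
  refine Set.ncard_le_ncard_of_injOn (fun g => (g.coeff 1, g.coeff 0)) ?_ ?_ (Set.toFinite _)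
  · rintro g ⟨f, hf, rfl⟩
    simpa using hf.coeff_zero_pow
  · have key : ∀ g ∈ liarSet n, g = X ^ 2 + C (g.coeff 1) * X + C (g.coeff 0) := by
      rintro g ⟨f, hf, rfl⟩
      have hd : (f.map (Int.castRingHom (ZMod n))).natDegree ≤ 2 :=
        natDegree_map_le.trans hf.natDegree_eq.le
      have hc2 : f.coeff 2 = 1 := by
        have h := hf.monic.coeff_natDegree
        rwa [hf.natDegree_eq] at h
      conv_lhs => rw [as_sum_range_C_mul_X_pow' _ (Nat.lt_succ_of_le hd)]
      simp [Finset.sum_range_succ, hc2]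
      ring
    intro g hg h hh e
    simp only [Prod.mk.injEq] at e
    rw [key g hg, key h hh, e.1, e.2]

/-! ### Roots of unity modulo `d` -/

theorem rootCount_eq_card (d r : ℕ) [NeZero d] :
    rootCount d r = ((Finset.univ : Finset (ZMod d)).filter (fun b => b ^ r = 1)).card := by
  rw [rootCount, ← Set.ncard_coe_finset]
  simp

theorem rootCount_le_self (d r : ℕ) [NeZero d] : rootCount d r ≤ d := by
  rw [rootCount_eq_card]
  exact (Finset.card_le_univ _).trans_eq (ZMod.card d)

/-- Reduction modulo `d` sends roots to roots and has fibres of size `m`; no coprimality of `d` and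
`m` is needed. -/
theorem rootCount_mul_le {d m : ℕ} (hd : 0 < d) (hm : 0 < m) (r : ℕ) :
    rootCount (d * m) r ≤ m * rootCount d r := by
  have : NeZero d := ⟨hd.ne'⟩
  have : NeZero (d * m) := ⟨(Nat.mul_pos hd hm).ne'⟩
  have hcard : ({b : ZMod d | b ^ r = 1} ×ˢ (Set.Iio m) : Set (ZMod d × ℕ)).ncard
      = m * rootCount d r := by
    rw [Set.ncard_prod, rootCount, mul_comm]
    congr 1
    rw [← Finset.coe_Iio, Set.ncard_coe_finset, Nat.card_Iio]
  rw [← hcard]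
  refine Set.ncard_le_ncard_of_injOn
    (fun b => (ZMod.castHom (dvd_mul_right d m) (ZMod d) b, b.val / d)) ?_ ?_
    ((Set.toFinite _).prod (Set.finite_Iio m))
  · intro b hb
    refine ⟨?_, ?_⟩
    · change (ZMod.castHom (dvd_mul_right d m) (ZMod d) b) ^ r = 1
      rw [← map_pow, hb.out, map_one]
    · exact Nat.div_lt_of_lt_mul b.val_lt
  · intro b _ c _ h
    simp only [Prod.mk.injEq] at h
    obtain ⟨h1, h2⟩ := h
    apply ZMod.val_injective
    have h3 : b.val % d = c.val % d := by
      rw [ZMod.castHom_apply, ZMod.castHom_apply, ZMod.cast_eq_val, ZMod.cast_eq_val] at h1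
      exact (ZMod.natCast_eq_natCast_iff' _ _ _).mp h1
    rw [← Nat.div_add_mod b.val d, ← Nat.div_add_mod c.val d, h2, h3]

theorem rootCount_prime_le {p r : ℕ} (hp : p.Prime) (hr : 0 < r) :
    rootCount p r ≤ r.gcd (p - 1) := by
  have : Fact p.Prime := ⟨hp⟩
  have hg : 0 < r.gcd (p - 1) := Nat.gcd_pos_of_pos_left _ hr
  rw [rootCount_eq_card]
  refine (Finset.card_le_card fun b hb => ?_).trans
    ((Multiset.toFinset_card_le _).trans (card_nthRoots (r.gcd (p - 1)) (1 : ZMod p)))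
  simp only [Finset.mem_filter, Finset.mem_univ, true_and] at hb
  rw [Multiset.mem_toFinset, mem_nthRoots hg]
  have hb0 : b ≠ 0 := by
    rintro rfl
    simp [zero_pow hr.ne'] at hb
  exact pow_gcd_eq_one.mpr ⟨hb, ZMod.pow_card_sub_one_eq_one hb0⟩

/-- Uniqueness in Hensel's lemma: the derivative `r b ^ (r - 1)` of `X ^ r - 1` is a unit at `b`. -/
theorem pow_injOn_of_isNilpotent_sub {R : Type*} [CommRing R] {r : ℕ} (hr : 0 < r)
    (hu : IsUnit (r : R)) {b c : R} (hb : b ^ r = 1) (hc : c ^ r = 1)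
    (hbc : IsNilpotent (b - c)) : b = c := by
  have hbu : IsUnit b := IsUnit.of_pow_eq_one hb hr.ne'
  have := existsUnique_nilpotent_sub_and_aeval_eq_zero (R := R) (S := R) (P := X ^ r - 1)
    (x := b) (by simp [hb]) (by simpa [derivative_X_pow] using ⟨hu, hbu.pow (r - 1)⟩)
  exact this.unique ⟨by simp, by simp [hb]⟩ ⟨hbc, by simp [hc]⟩

theorem isNilpotent_of_forall_prime_dvd {d : ℕ} (hd : d ≠ 0) {z : ℤ}
    (h : ∀ p ∈ d.primeFactors, (p : ℤ) ∣ z) : IsNilpotent (z : ZMod d) := by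
  rcases eq_or_ne z 0 with rfl | hz
  · simp
  -- The exponent `d` suffices because the `p`-adic valuation of `d` is less than `d`.
  refine ⟨d, ?_⟩
  rw [← Int.cast_pow, ZMod.intCast_zmod_eq_zero_iff_dvd, ← Int.natAbs_dvd_natAbs, Int.natAbs_pow,
    Int.natAbs_natCast]
  have hz' : z.natAbs ≠ 0 := Int.natAbs_ne_zero.mpr hz
  rw [← Nat.factorization_le_iff_dvd hd (pow_ne_zero _ hz')]
  intro p
  by_cases hp : p ∈ d.primeFactors
  · have h1 : p ∣ z.natAbs := Int.natCast_dvd.mp (h p hp)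
    have h2 : 1 ≤ z.natAbs.factorization p :=
      (Nat.prime_of_mem_primeFactors hp).factorization_pos_of_dvd hz' h1
    rw [Nat.factorization_pow, Finsupp.smul_apply, smul_eq_mul]
    exact ((Nat.factorization_lt p hd).le).trans (Nat.le_mul_of_pos_right _ h2)
  · rw [Finsupp.notMem_support_iff.mp (by rwa [Nat.support_factorization])]
    exact Nat.zero_le _

/-- Two roots agreeing modulo every prime `p ∣ d` differ by a nilpotent, hence coincide. So only the
residue fields count, and prime powers give no extra roots. -/
theorem rootCount_le_prod {d r : ℕ} (hd : d ≠ 0) (hr : 0 < r) (hdr : r.Coprime d) :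
    rootCount d r ≤ ∏ p ∈ d.primeFactors, r.gcd (p - 1) := by
  have : NeZero d := ⟨hd⟩
  have hne : ∀ p : d.primeFactors, NeZero (p : ℕ) := fun p =>
    ⟨(Nat.prime_of_mem_primeFactors p.2).ne_zero⟩
  let Φ : {b : ZMod d | b ^ r = 1} → ((p : d.primeFactors) → {b : ZMod p | b ^ r = 1}) :=
    fun b p => ⟨ZMod.castHom (Nat.dvd_of_mem_primeFactors p.2) (ZMod p) b.1, by
      change (ZMod.castHom _ (ZMod p) b.1) ^ r = 1
      rw [← map_pow, b.2.out, map_one]⟩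
  have hΦ : Function.Injective Φ := by
    intro b c h
    apply Subtype.ext
    refine pow_injOn_of_isNilpotent_sub hr ((ZMod.isUnit_iff_coprime r d).mpr hdr) b.2 c.2 ?_
    have hbc : b.1 - c.1 = (((b.1.val : ℤ) - (c.1.val : ℤ) : ℤ) : ZMod d) := by simp
    rw [hbc]
    refine isNilpotent_of_forall_prime_dvd hd fun p hp => ?_
    have h1 := congrArg Subtype.val (congrFun h ⟨p, hp⟩)
    simp only [Φ, ZMod.castHom_apply, ZMod.cast_eq_val] at h1
    rw [← ZMod.intCast_zmod_eq_zero_iff_dvd]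
    simpa [sub_eq_zero] using h1
  calc rootCount d r = Nat.card {b : ZMod d | b ^ r = 1} := rfl
    _ ≤ Nat.card ((p : d.primeFactors) → {b : ZMod p | b ^ r = 1}) :=
        Nat.card_le_card_of_injective Φ hΦ
    _ = ∏ p : d.primeFactors, rootCount p r := Nat.card_pi
    _ ≤ ∏ p : d.primeFactors, r.gcd (p - 1) :=
        Finset.prod_le_prod' fun p _ => rootCount_prime_le (Nat.prime_of_mem_primeFactors p.2) hr
    _ = _ := Finset.prod_coe_sort d.primeFactors (fun p => r.gcd (p - 1))

/-! ### Averages over multipliers and divisors -/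

theorem card_le_div_add_one_of_modEq {M r : ℕ} {S : Finset ℕ} (hS : ∀ m ∈ S, m ≤ M)
    (h : ∀ m ∈ S, ∀ k ∈ S, m ≡ k [MOD r]) : S.card ≤ M / r + 1 := by
  rw [← Finset.card_range (M / r + 1)]
  refine Finset.card_le_card_of_injOn (· / r) (fun m hm => ?_) fun m hm k hk e => ?_
  · simpa [Nat.lt_succ_iff] using Nat.div_le_div_right (hS m hm)
  · have e' : m / r = k / r := e
    rw [← Nat.div_add_mod m r, ← Nat.div_add_mod k r, e', h m hm k hk]

/-- Swap the sums and group `b` by its order `r`: `r ∣ d * m - 1` forces `r` to be coprime to `d`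
and fixes `m` modulo `r`, leaving at most `M / r + 1` values. The `+ 1`s add up to the term `d`. -/
theorem sum_rootCount_mul_sub_one_le {d : ℕ} (hd : 0 < d) (M : ℕ) :
    ∑ m ∈ Finset.Icc 1 M, (rootCount d (d * m - 1) : ℝ) ≤
      d + ∑ r ∈ (Finset.Icc 1 (d * M)).filter (fun r => r.Coprime d),
        (M / r : ℝ) * rootCount d r := by
  have : NeZero d := ⟨hd.ne'⟩
  set R := (Finset.Icc 1 (d * M)).filter (fun r => r.Coprime d) with hR
  let S : ZMod d → Finset ℕ := fun b => (Finset.Icc 1 M).filter (fun m => b ^ (d * m - 1) = 1)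
  have hswap : ∑ m ∈ Finset.Icc 1 M, (rootCount d (d * m - 1) : ℝ)
      = ∑ b : ZMod d, ((S b).card : ℝ) := by
    simp only [rootCount_eq_card, S, Finset.card_filter]
    push_cast
    exact Finset.sum_comm
  have hpt : ∀ b : ZMod d, ((S b).card : ℝ) ≤
      1 + ∑ r ∈ R, (if orderOf b = r then (M / r : ℝ) else 0) := by
    intro b
    have hnn : 0 ≤ ∑ r ∈ R, (if orderOf b = r then (M / r : ℝ) else 0) :=
      Finset.sum_nonneg fun r _ => by split_ifs <;> positivity
    rcases (S b).eq_empty_or_nonempty with h | ⟨m₀, hm₀⟩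
    · rw [h, Finset.card_empty, Nat.cast_zero]
      linarith
    have hmem : ∀ m ∈ S b, 1 ≤ m ∧ m ≤ M ∧ orderOf b ∣ d * m - 1 := by
      intro m hm
      simp only [S, Finset.mem_filter, Finset.mem_Icc] at hm
      exact ⟨hm.1.1, hm.1.2, orderOf_dvd_of_pow_eq_one hm.2⟩
    have hcop : ∀ m ∈ S b, (orderOf b).Coprime d ∧ d * m ≡ 1 [MOD orderOf b] := by
      intro m hm
      obtain ⟨h1, -, h3⟩ := hmem m hm
      have h1' : 1 ≤ d * m := Nat.mul_pos hd h1
      refine ⟨?_, ((Nat.modEq_iff_dvd' h1').mpr h3).symm⟩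
      rw [Nat.coprime_iff_gcd_eq_one, ← Nat.dvd_one]
      have h5 := (Nat.dvd_sub_iff_right h1' ((Nat.gcd_dvd_right (orderOf b) d).mul_right m)).mp
        ((Nat.gcd_dvd_left _ _).trans h3)
      exact h5
    obtain ⟨h1, h2, h3⟩ := hmem m₀ hm₀
    have hpos : 0 < orderOf b ∧ orderOf b ≤ d * M := by
      -- A zero exponent bounds no order, but it occurs only for `d = m₀ = 1`, where `ZMod d` is
      -- trivial.
      rcases Nat.eq_zero_or_pos (d * m₀ - 1) with h0 | h0
      · have hd1 : d = 1 := by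
          have : d * m₀ ≤ 1 := by omega
          nlinarith
        subst hd1
        have : b = 1 := Subsingleton.elim _ _
        rw [this, orderOf_one]
        omega
      · refine ⟨Nat.pos_of_dvd_of_pos h3 h0, (Nat.le_of_dvd h0 h3).trans ?_⟩
        exact (Nat.sub_le _ _).trans (Nat.mul_le_mul_left _ h2)
    have hrR : orderOf b ∈ R := by
      rw [hR, Finset.mem_filter, Finset.mem_Icc]
      exact ⟨hpos, (hcop m₀ hm₀).1⟩
    rw [Finset.sum_ite_eq, if_pos hrR]
    have hc : (S b).card ≤ M / orderOf b + 1 := by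
      refine card_le_div_add_one_of_modEq (fun m hm => (hmem m hm).2.1) fun m hm k hk => ?_
      exact Nat.ModEq.cancel_left_of_coprime (hcop m hm).1
        ((hcop m hm).2.trans (hcop k hk).2.symm)
    calc ((S b).card : ℝ) ≤ ((M / orderOf b : ℕ) : ℝ) + 1 := by exact_mod_cast hc
      _ ≤ (M / orderOf b : ℝ) + 1 := by gcongr; exact Nat.cast_div_le
      _ = _ := add_comm _ _
  rw [hswap]
  calc ∑ b : ZMod d, ((S b).card : ℝ)
      ≤ ∑ b : ZMod d, (1 + ∑ r ∈ R, (if orderOf b = r then (M / r : ℝ) else 0)) :=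
        Finset.sum_le_sum fun b _ => hpt b
    _ = d + ∑ r ∈ R, ∑ b : ZMod d, (if orderOf b = r then (M / r : ℝ) else 0) := by
        rw [Finset.sum_add_distrib, Finset.sum_comm]
        simp [ZMod.card]
    _ ≤ _ := by
        gcongr with r hr
        rw [← Finset.sum_filter, Finset.sum_const, nsmul_eq_mul, mul_comm, rootCount_eq_card]
        gcongr with b
        rintro rfl
        exact pow_orderOf_eq_one b

theorem sum_inv_Icc_le_one_add_log (K : ℕ) :
    ∑ h ∈ Finset.Icc 1 K, (1 / h : ℝ) ≤ 1 + Real.log K := by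
  have := harmonic_le_one_add_log K
  rw [harmonic_eq_sum_Icc] at this
  push_cast at this
  simpa using this

theorem sum_card_divisors_le (K : ℕ) :
    ∑ k ∈ Finset.Icc 1 K, (k.divisors.card : ℝ) ≤ K * (1 + Real.log K) := by
  have h1 : ∀ k ∈ Finset.Icc 1 K, (k.divisors.card : ℝ) =
      ∑ h ∈ Finset.Icc 1 K, (if h ∣ k then 1 else 0 : ℝ) := by
    intro k hk
    rw [Finset.mem_Icc] at hk
    rw [← Finset.sum_filter, Finset.sum_const, nsmul_eq_mul, mul_one]
    congr 2
    ext h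
    simp only [Nat.mem_divisors, Finset.mem_filter, Finset.mem_Icc]
    constructor
    · rintro ⟨h2, -⟩
      exact ⟨⟨Nat.pos_of_dvd_of_pos h2 hk.1, (Nat.le_of_dvd hk.1 h2).trans hk.2⟩, h2⟩
    · rintro ⟨-, h2⟩
      exact ⟨h2, by omega⟩
  rw [Finset.sum_congr rfl h1, Finset.sum_comm]
  calc ∑ h ∈ Finset.Icc 1 K, ∑ k ∈ Finset.Icc 1 K, (if h ∣ k then 1 else 0 : ℝ)
      ≤ ∑ h ∈ Finset.Icc 1 K, (K : ℝ) * (1 / h) := by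
        refine Finset.sum_le_sum fun h _ => ?_
        rw [← Finset.sum_filter, Finset.sum_const, nsmul_eq_mul, mul_one, mul_one_div]
        have : ((Finset.Icc 1 K).filter (fun k => h ∣ k)).card = K / h :=
          Nat.Ioc_filter_dvd_card_eq_div K h
        rw [this]
        exact Nat.cast_div_le
    _ = K * ∑ h ∈ Finset.Icc 1 K, (1 / h : ℝ) := by rw [Finset.mul_sum]
    _ ≤ _ := by gcongr; exact sum_inv_Icc_le_one_add_log K

/-- Bound the gcd by the sum of all common divisors `h`; each `h ∣ k` occurs at most `K / h` times,
so contributes at most `K`. -/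
theorem sum_gcd_pred_le {k : ℕ} (hk : 0 < k) (K : ℕ) :
    ∑ p ∈ Finset.Icc 2 K, (k.gcd (p - 1) : ℝ) ≤ K * k.divisors.card := by
  calc ∑ p ∈ Finset.Icc 2 K, (k.gcd (p - 1) : ℝ)
      ≤ ∑ p ∈ Finset.Icc 2 K, ∑ h ∈ k.divisors, (if h ∣ p - 1 then (h : ℝ) else 0) := by
        refine Finset.sum_le_sum fun p _ => ?_
        have hmem : k.gcd (p - 1) ∈ k.divisors :=
          Nat.mem_divisors.mpr ⟨Nat.gcd_dvd_left _ _, hk.ne'⟩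
        refine le_trans ?_ (Finset.single_le_sum (fun h _ => ?_) hmem)
        · rw [if_pos (Nat.gcd_dvd_right _ _)]
        · split_ifs <;> positivity
    _ = ∑ h ∈ k.divisors, ∑ p ∈ Finset.Icc 2 K, (if h ∣ p - 1 then (h : ℝ) else 0) :=
        Finset.sum_comm
    _ ≤ ∑ h ∈ k.divisors, (K : ℝ) := by
        refine Finset.sum_le_sum fun h hh => ?_
        have hpos : (0 : ℝ) < h := by exact_mod_cast Nat.pos_of_mem_divisors hh
        rw [← Finset.sum_filter, Finset.sum_const, nsmul_eq_mul, ← le_div_iff₀ hpos]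
        refine le_trans ?_ (Nat.cast_div_le (m := K) (n := h))
        rw [← Nat.Ioc_filter_dvd_card_eq_div K h]
        norm_cast
        refine Finset.card_le_card_of_injOn (· - 1) (fun p hp => ?_) fun p hp q hq e => ?_
        · simp only [Finset.coe_filter, Finset.mem_Icc, Finset.mem_Ioc, Set.mem_ofPred_eq] at hp ⊢
          exact ⟨by omega, hp.2⟩
        · simp only [Finset.coe_filter, Finset.mem_Icc, Set.mem_ofPred_eq] at hp hq e
          omega
    _ = _ := by rw [Finset.sum_const, nsmul_eq_mul, mul_comm]

/-! ### Splitting the composite `n` -/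

/-- Re-indexing with overcounting: `g` need not be injective, since one preimage per `s` suffices
and the other weights are nonnegative. -/
theorem sum_le_sum_of_exists {ι κ : Type*} {S : Finset ι} {T : Finset κ} {F : ι → ℝ}
    {w : κ → ℝ} (g : κ → ι) (hw : ∀ t ∈ T, 0 ≤ w t)
    (h : ∀ s ∈ S, ∃ t ∈ T, g t = s ∧ F s ≤ w t) : ∑ s ∈ S, F s ≤ ∑ t ∈ T, w t := by
  classical
  rcases S.eq_empty_or_nonempty with rfl | ⟨s₀, hs₀⟩
  · simpa using Finset.sum_nonneg hw
  have : Nonempty κ := ⟨(h s₀ hs₀).choose⟩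
  choose! q hqT hqg hqw using h
  have hinj : Set.InjOn q S := fun a ha b hb e => by rw [← hqg a ha, e, hqg b hb]
  calc ∑ s ∈ S, F s ≤ ∑ s ∈ S, w (q s) := Finset.sum_le_sum hqw
    _ = ∑ t ∈ S.image q, w t := (Finset.sum_image hinj).symm
    _ ≤ ∑ t ∈ T, w t := Finset.sum_le_sum_of_subset_of_nonneg
        (Finset.image_subset_iff.mpr hqT) fun t ht _ => hw t ht

/-- Take the largest divisor `d` with `d * P ≤ N`. Were `d * P ^ 2 ≤ N`, a prime factor of `n / d`,
being at most `P`, could be absorbed into `d`. -/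
theorem exists_dvd_between {n N P : ℕ} (hn : n ≤ N) (hn0 : 0 < n) (hPN : P ≤ N)
    (hnP : N < n * P) (h : ∀ p, p.Prime → p ∣ n → p ≤ P) :
    ∃ d, d ∣ n ∧ d * P ≤ N ∧ N < d * P ^ 2 := by
  obtain ⟨d, hd⟩ := (n.divisors.filter (fun d => d * P ≤ N)).exists_maximal
    ⟨1, by simp [hn0.ne', hPN]⟩
  obtain ⟨hd1, hd2⟩ := hd
  simp only [Finset.mem_filter, Nat.mem_divisors] at hd1 hd2
  obtain ⟨⟨⟨m, rfl⟩, -⟩, hdP⟩ := hd1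
  have hm : m ≠ 1 := by
    rintro rfl
    rw [mul_one] at hnP
    omega
  obtain ⟨p, hp, k, rfl⟩ := Nat.exists_prime_and_dvd hm
  have hd0 : 0 < d := Nat.pos_of_mul_pos_right hn0
  refine ⟨d, dvd_mul_right _ _, hdP, ?_⟩
  by_contra hcon
  have hpP : p ≤ P := h p hp ⟨d * k, by ring⟩
  have hle : d * p * P ≤ N := by
    calc d * p * P ≤ d * P * P := by gcongr
      _ = d * P ^ 2 := by ring
      _ ≤ N := not_lt.mp hcon
  have h1 := hd2 (y := d * p) ⟨⟨⟨k, by ring⟩, hn0.ne'⟩, hle⟩ (Nat.le_mul_of_pos_right _ hp.pos)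
  have := hp.two_le
  nlinarith

open scoped Classical in
theorem sum_rootCount_largePrime_le {N P : ℕ} (hP : 0 < P) :
    ∑ n ∈ (Finset.Icc 1 N).filter (fun n => IsComposite n ∧ ∃ p, p.Prime ∧ p ∣ n ∧ P < p),
      (rootCount n (n - 1) : ℝ) ≤ (N : ℝ) ^ 2 / P * (1 + Real.log N) := by
  let T : Finset (Σ _ : ℕ, ℕ) := (Finset.Icc 2 (N / P)).sigma fun m => Finset.Icc 2 (N / m)
  calc _ ≤ ∑ t ∈ T, (t.1 * (t.1 - 1).gcd (t.2 - 1) : ℝ) := by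
        refine sum_le_sum_of_exists (fun t => t.2 * t.1) (fun _ _ => by positivity) ?_
        intro n hn
        simp only [Finset.mem_filter, Finset.mem_Icc] at hn
        obtain ⟨⟨hn1, hnN⟩, ⟨-, hnp⟩, p, hp, ⟨m, rfl⟩, hPp⟩ := hn
        -- Compositeness matters here: for `m = 1` the gcd below would be `gcd(0, p - 1) = p - 1`,
        -- with no saving.
        have hm : 2 ≤ m := by
          rcases Nat.lt_or_ge m 2 with h | h
          · interval_cases m
            · omega
            · exact absurd (by simpa using hp) hnp
          · exact h
        refine ⟨⟨m, p⟩, ?_, rfl, ?_⟩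
        · simp only [T, Finset.mem_sigma, Finset.mem_Icc]
          refine ⟨⟨hm, ?_⟩, hp.two_le, ?_⟩
          · rw [Nat.le_div_iff_mul_le hP]
            calc m * P ≤ m * p := by gcongr
              _ ≤ N := by rwa [mul_comm]
          · rwa [Nat.le_div_iff_mul_le (by omega)]
        -- `p * m - 1 = (m - 1) + (p - 1) * m`.
        · have hgcd : (p * m - 1).gcd (p - 1) = (m - 1).gcd (p - 1) := by
            obtain ⟨q, rfl⟩ : ∃ q, p = q + 1 := ⟨p - 1, by have := hp.two_le; omega⟩
            have : (q + 1) * m - 1 = (m - 1) + q * m := by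
              rw [add_mul, one_mul]; omega
            rw [this, Nat.add_sub_cancel]
            simp
          have h0 : 0 < p * m - 1 := by
            have : 2 * 2 ≤ p * m := Nat.mul_le_mul hp.two_le hm
            omega
          have := (rootCount_mul_le hp.pos (by omega : 0 < m) (p * m - 1)).trans
            (Nat.mul_le_mul_left m (rootCount_prime_le hp h0))
          rw [hgcd] at this
          exact_mod_cast this
    _ = ∑ m ∈ Finset.Icc 2 (N / P), m * ∑ p ∈ Finset.Icc 2 (N / m), ((m - 1).gcd (p - 1) : ℝ) := by
        rw [Finset.sum_sigma]
        simp only [Finset.mul_sum]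
    _ ≤ ∑ m ∈ Finset.Icc 2 (N / P), (N : ℝ) * (m - 1).divisors.card := by
        refine Finset.sum_le_sum fun m hm => ?_
        rw [Finset.mem_Icc] at hm
        have hm0 : (0 : ℝ) < m := by exact_mod_cast (by omega : 0 < m)
        calc (m : ℝ) * ∑ p ∈ Finset.Icc 2 (N / m), ((m - 1).gcd (p - 1) : ℝ)
            ≤ m * ((N / m : ℕ) * (m - 1).divisors.card) := by
              gcongr
              exact sum_gcd_pred_le (by omega) _
          _ ≤ m * ((N / m : ℝ) * (m - 1).divisors.card) := by
              gcongr
              exact Nat.cast_div_le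
          _ = _ := by field_simp
    _ = N * ∑ m ∈ Finset.Icc 2 (N / P), ((m - 1).divisors.card : ℝ) := by rw [Finset.mul_sum]
    _ ≤ N * ∑ k ∈ Finset.Icc 1 (N / P), (k.divisors.card : ℝ) := by
        gcongr
        refine sum_le_sum_of_exists (· + 1) (fun _ _ => by positivity) fun m hm => ?_
        rw [Finset.mem_Icc] at hm
        exact ⟨m - 1, Finset.mem_Icc.mpr (by omega), Nat.sub_add_cancel (by omega), le_rfl⟩
    _ ≤ N * ((N / P : ℕ) * (1 + Real.log (N / P : ℕ))) := by
        gcongr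
        exact sum_card_divisors_le _
    _ ≤ N * ((N / P : ℝ) * (1 + Real.log N)) := by
        have h1 : Real.log (N / P : ℕ) ≤ Real.log N := by
          rcases Nat.eq_zero_or_pos (N / P) with h | h
          · rw [h]
            simpa using Real.log_natCast_nonneg N
          · exact Real.log_le_log (by exact_mod_cast h) (by exact_mod_cast Nat.div_le_self _ _)
        have h2 := Real.log_natCast_nonneg (N / P)
        gcongr
        exact Nat.cast_div_le
    _ = _ := by ring

open scoped Classical in
theorem sum_rootCount_smooth_le {N P : ℕ} (hP : 0 < P) (hPN : P ≤ N) :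
    ∑ n ∈ (Finset.Icc 1 N).filter (fun n => N < n * P ∧ ∀ p, p.Prime → p ∣ n → p ≤ P),
      (rootCount n (n - 1) : ℝ) ≤ (N : ℝ) ^ 2 / P + (N : ℝ) ^ 2 * ∑ r ∈ Finset.Icc 1 N, 1 / (r : ℝ) *
        ∑ d ∈ (Finset.Icc 1 N).filter (fun d => r.Coprime d ∧ N < d * P ^ 2),
          (rootCount d r : ℝ) / (d : ℝ) ^ 2 := by
  let D : Finset ℕ := (Finset.Icc 1 N).filter (fun d => d * P ≤ N ∧ N < d * P ^ 2)
  let T : Finset (Σ _ : ℕ, ℕ) := D.sigma fun d => Finset.Icc 1 (N / d)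
  have hD : ∀ d ∈ D, 1 ≤ d ∧ d ≤ N ∧ d * P ≤ N ∧ N < d * P ^ 2 := by
    intro d hd
    simpa only [D, Finset.mem_filter, Finset.mem_Icc, and_assoc] using hd
  calc _ ≤ ∑ t ∈ T, (t.2 * rootCount t.1 (t.1 * t.2 - 1) : ℝ) := by
        refine sum_le_sum_of_exists (fun t => t.1 * t.2) (fun _ _ => by positivity) ?_
        intro n hn
        simp only [Finset.mem_filter, Finset.mem_Icc] at hn
        obtain ⟨⟨hn1, hnN⟩, hnP, hsm⟩ := hn
        obtain ⟨d, ⟨m, rfl⟩, hd1, hd2⟩ := exists_dvd_between hnN hn1 hPN hnP hsm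
        have hd0 : 0 < d := Nat.pos_of_mul_pos_right hn1
        have hm0 : 0 < m := Nat.pos_of_mul_pos_left hn1
        refine ⟨⟨d, m⟩, ?_, rfl, by exact_mod_cast rootCount_mul_le hd0 hm0 _⟩
        simp only [T, D, Finset.mem_sigma, Finset.mem_filter, Finset.mem_Icc]
        refine ⟨⟨⟨hd0, (Nat.le_mul_of_pos_right _ hm0).trans hnN⟩, hd1, hd2⟩, hm0, ?_⟩
        rw [Nat.le_div_iff_mul_le hd0, mul_comm]
        exact hnN
    _ = ∑ d ∈ D, ∑ m ∈ Finset.Icc 1 (N / d), (m * rootCount d (d * m - 1) : ℝ) := by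
        rw [Finset.sum_sigma]
    _ ≤ ∑ d ∈ D, (N / d : ℝ) * ∑ m ∈ Finset.Icc 1 (N / d), (rootCount d (d * m - 1) : ℝ) := by
        refine Finset.sum_le_sum fun d _ => ?_
        rw [Finset.mul_sum]
        refine Finset.sum_le_sum fun m hm => ?_
        rw [Finset.mem_Icc] at hm
        gcongr
        exact (Nat.cast_le.mpr hm.2).trans Nat.cast_div_le
    _ ≤ ∑ d ∈ D, (N / d : ℝ) * (d + ∑ r ∈ (Finset.Icc 1 N).filter (fun r => r.Coprime d),
          (N / d / r : ℝ) * rootCount d r) := by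
        refine Finset.sum_le_sum fun d hd => ?_
        refine mul_le_mul_of_nonneg_left ((sum_rootCount_mul_sub_one_le (hD d hd).1 _).trans ?_)
          (by positivity)
        refine add_le_add le_rfl ((Finset.sum_le_sum_of_subset_of_nonneg
          (Finset.filter_subset_filter _ (Finset.Icc_subset_Icc_right (Nat.mul_div_le N d)))
          fun _ _ _ => by positivity).trans (Finset.sum_le_sum fun r _ => ?_))
        gcongr
        exact Nat.cast_div_le
    _ = ∑ d ∈ D, ((N : ℝ) + (N : ℝ) ^ 2 * ∑ r ∈ Finset.Icc 1 N,
          if r.Coprime d then 1 / (r : ℝ) * ((rootCount d r : ℝ) / (d : ℝ) ^ 2) else 0) := by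
        refine Finset.sum_congr rfl fun d hd => ?_
        have hd0 : (d : ℝ) ≠ 0 := by exact_mod_cast (Nat.one_le_iff_ne_zero.mp (hD d hd).1)
        rw [mul_add, div_mul_cancel₀ _ hd0, Finset.mul_sum, ← Finset.sum_filter, Finset.mul_sum]
        congr 1
        refine Finset.sum_congr rfl fun r hr => ?_
        simp only [div_eq_mul_inv]
        ring
    _ = D.card * N + (N : ℝ) ^ 2 * ∑ r ∈ Finset.Icc 1 N, 1 / (r : ℝ) *
          ∑ d ∈ D.filter (fun d => r.Coprime d), ((rootCount d r : ℝ) / (d : ℝ) ^ 2) := by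
        rw [Finset.sum_add_distrib, Finset.sum_const, nsmul_eq_mul, ← Finset.mul_sum,
          Finset.sum_comm]
        refine congrArg (fun s => _ + _ * s) (Finset.sum_congr rfl fun r _ => ?_)
        rw [Finset.sum_filter (fun d => r.Coprime d), Finset.mul_sum]
        refine Finset.sum_congr rfl fun d _ => ?_
        split_ifs <;> simp
    _ ≤ _ := by
        have hcard : (D.card : ℝ) ≤ N / P := by
          refine le_trans ?_ (Nat.cast_div_le (m := N) (n := P))
          rw [Nat.cast_le]
          calc D.card ≤ (Finset.Icc 1 (N / P)).card := by
                refine Finset.card_le_card fun d hd => ?_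
                obtain ⟨h1, -, h2, -⟩ := hD d hd
                rw [Finset.mem_Icc, Nat.le_div_iff_mul_le hP]
                exact ⟨h1, h2⟩
            _ = N / P := by simp
        gcongr with r hr
        · calc (D.card : ℝ) * N ≤ N / P * N := by gcongr
            _ = _ := by ring
        · intro d hd
          simp only [D, Finset.mem_filter] at hd ⊢
          exact ⟨hd.1.1, hd.2, hd.1.2.2⟩

theorem sum_rootCount_composite_le {N P : ℕ} (hP : 0 < P) (hPN : P ≤ N) :
    ∑ n ∈ (Finset.Icc 1 N).filter IsComposite, (rootCount n (n - 1) : ℝ) ≤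
      (N : ℝ) ^ 2 / P * (3 + Real.log N) + (N : ℝ) ^ 2 * ∑ r ∈ Finset.Icc 1 N, 1 / (r : ℝ) *
        ∑ d ∈ (Finset.Icc 1 N).filter (fun d => r.Coprime d ∧ N < d * P ^ 2),
          (rootCount d r : ℝ) / (d : ℝ) ^ 2 := by
  classical
  set S₂ := (Finset.Icc 1 N).filter
    (fun n => IsComposite n ∧ ∃ p, p.Prime ∧ p ∣ n ∧ P < p) with hS₂
  set S₃ := (Finset.Icc 1 N).filter
    (fun n => N < n * P ∧ ∀ p, p.Prime → p ∣ n → p ≤ P) with hS₃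
  have hsub : (Finset.Icc 1 N).filter IsComposite ⊆ Finset.Icc 1 (N / P) ∪ (S₂ ∪ S₃) := by
    intro n hn
    simp only [hS₂, hS₃, Finset.mem_union, Finset.mem_filter, Finset.mem_Icc] at hn ⊢
    rw [Nat.le_div_iff_mul_le hP]
    by_cases h1 : n * P ≤ N
    · exact Or.inl ⟨hn.1.1, h1⟩
    by_cases h2 : ∃ p, p.Prime ∧ p ∣ n ∧ P < p
    · exact Or.inr (Or.inl ⟨hn.1, hn.2, h2⟩)
    · push Not at h1 h2
      exact Or.inr (Or.inr ⟨hn.1, h1, h2⟩)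
  have hsmall : ∑ n ∈ Finset.Icc 1 (N / P), (rootCount n (n - 1) : ℝ) ≤ (N : ℝ) ^ 2 / P := by
    calc ∑ n ∈ Finset.Icc 1 (N / P), (rootCount n (n - 1) : ℝ)
        ≤ ∑ n ∈ Finset.Icc 1 (N / P), (N : ℝ) := by
          refine Finset.sum_le_sum fun n hn => ?_
          rw [Finset.mem_Icc] at hn
          have : NeZero n := ⟨by omega⟩
          exact_mod_cast (rootCount_le_self n _).trans (hn.2.trans (Nat.div_le_self _ _))
      _ = (N / P : ℕ) * N := by simp
      _ ≤ (N / P : ℝ) * N := by gcongr; exact Nat.cast_div_le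
      _ = _ := by ring
  have h2 := sum_rootCount_largePrime_le (N := N) hP
  have h3 := sum_rootCount_smooth_le hP hPN
  have hunion : ∀ A B : Finset ℕ, ∑ n ∈ A ∪ B, (rootCount n (n - 1) : ℝ) ≤
      ∑ n ∈ A, (rootCount n (n - 1) : ℝ) + ∑ n ∈ B, (rootCount n (n - 1) : ℝ) := by
    intro A B
    rw [← Finset.sum_union_inter]
    exact le_add_of_nonneg_right (Finset.sum_nonneg fun _ _ => by positivity)
  calc _ ≤ ∑ n ∈ Finset.Icc 1 (N / P) ∪ (S₂ ∪ S₃), (rootCount n (n - 1) : ℝ) :=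
        Finset.sum_le_sum_of_subset_of_nonneg hsub fun _ _ _ => by positivity
    _ ≤ _ := (hunion _ _).trans (add_le_add hsmall ((hunion _ _).trans (add_le_add h2 h3)))
    _ = _ := by ring

/-! ### Euler products and Rankin's trick -/

/-- Each Euler factor is at most `1 + 4 g(p) ≤ exp (4 g(p))`, where `4 = ∑ (3/4) ^ e`. The ratio
`3/4` is a convenient upper bound for `2 ^ (-1/2)`. -/
theorem sum_le_exp_sum_primes {f g : ℕ → ℝ} (hf0 : ∀ n, 0 ≤ f n) (hf1 : f 1 = 1)
    (hmul : ∀ {m n : ℕ}, m.Coprime n → f (m * n) = f m * f n)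
    (hfg : ∀ p, p.Prime → ∀ e : ℕ, f (p ^ (e + 1)) ≤ g p * (3 / 4) ^ e)
    {s T : Finset ℕ} (hT : ∀ d ∈ T, d ∈ Nat.factoredNumbers s) :
    ∑ d ∈ T, f d ≤ Real.exp (4 * ∑ p ∈ s.filter Nat.Prime, g p) := by
  have hgeo : HasSum (fun e : ℕ => ((3 : ℝ) / 4) ^ e) 4 := by
    convert hasSum_geometric_of_lt_one (r := (3 : ℝ) / 4) (by norm_num) (by norm_num) using 1
    norm_num
  have hs1 : ∀ p, p.Prime → Summable fun e : ℕ => f (p ^ (e + 1)) := fun p hp =>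
    Summable.of_nonneg_of_le (fun _ => hf0 _) (hfg p hp) (hgeo.summable.mul_left _)
  have hs : ∀ p, p.Prime → Summable fun e : ℕ => f (p ^ e) := fun p hp =>
    (summable_nat_add_iff 1).mp (hs1 p hp)
  obtain ⟨-, h2⟩ := EulerProduct.summable_and_hasSum_factoredNumbers_prod_filter_prime_tsum
    (f := f) hf1 (fun {m n} h => hmul h)
    (fun {p} hp => by simpa [Real.norm_of_nonneg (hf0 _)] using hs p hp) s
  have hsumT : ∑ d ∈ T, f d ≤ ∏ p ∈ s.filter Nat.Prime, ∑' e : ℕ, f (p ^ e) := by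
    have h3 := sum_le_hasSum (T.subtype (· ∈ Nat.factoredNumbers s)) (fun _ _ => hf0 _) h2
    rwa [Finset.sum_subtype_of_mem _ hT] at h3
  refine hsumT.trans ?_
  rw [Finset.mul_sum, Real.exp_sum]
  refine Finset.prod_le_prod (fun p _ => tsum_nonneg fun _ => hf0 _) fun p hp => ?_
  have hp' := (Finset.mem_filter.mp hp).2
  rw [(hs p hp').tsum_eq_zero_add, pow_zero, hf1]
  have h4 : ∑' e : ℕ, f (p ^ (e + 1)) ≤ g p * 4 :=
    hasSum_le (hfg p hp') (hs1 p hp').hasSum (hgeo.mul_left _)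
  linarith [Real.add_one_le_exp (4 * g p)]

theorem prime_rpow_neg_le {p : ℕ} (hp : p.Prime) {c : ℝ} (hc : 1 / 2 ≤ c) :
    (p : ℝ) ^ (-c) ≤ 3 / 4 := by
  have h2 : (2 : ℝ) ≤ p := by exact_mod_cast hp.two_le
  calc (p : ℝ) ^ (-c) ≤ (2 : ℝ) ^ (-c) :=
        Real.rpow_le_rpow_of_nonpos (by norm_num) h2 (by linarith)
    _ ≤ (2 : ℝ) ^ (-(1 / 2) : ℝ) := Real.rpow_le_rpow_of_exponent_le (by norm_num) (by linarith)
    _ = (√2)⁻¹ := by rw [Real.rpow_neg (by norm_num), Real.sqrt_eq_rpow]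
    _ ≤ 3 / 4 := by
        rw [inv_le_comm₀ (by positivity) (by norm_num)]
        exact Real.le_sqrt_of_sq_le (by norm_num)

theorem sum_divisors_rpow_neg_le (r : ℕ) {c : ℝ} (hc : 1 / 2 ≤ c) :
    ∑ h ∈ r.divisors, (h : ℝ) ^ (-c) ≤ Real.exp (4 * ∑ p ∈ r.primeFactors, (p : ℝ) ^ (-c)) := by
  have hfil : r.primeFactors.filter Nat.Prime = r.primeFactors :=
    Finset.filter_true_of_mem fun p hp => Nat.prime_of_mem_primeFactors hp
  rw [← hfil]
  refine sum_le_exp_sum_primes (f := fun n => (n : ℝ) ^ (-c)) (g := fun n => (n : ℝ) ^ (-c))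
    (fun n => by positivity) (by simp) (fun {m n} _ => ?_) (fun p hp e => ?_) fun d hd => ?_
  · rw [Nat.cast_mul, Real.mul_rpow (by positivity) (by positivity)]
  · rw [Nat.cast_pow, ← Real.rpow_natCast, ← Real.rpow_mul (by positivity), mul_comm,
      Real.rpow_mul (by positivity), Real.rpow_natCast, pow_succ']
    gcongr
    exact prime_rpow_neg_le hp hc
  · rw [Nat.mem_divisors] at hd
    exact Nat.mem_factoredNumbers_of_primeFactors_subset (ne_zero_of_dvd_ne_zero hd.2 hd.1)
      (Nat.primeFactors_mono hd.1 hd.2)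

theorem sum_prod_gcd_mul_rpow_le (r : ℕ) {N : ℕ} {c : ℝ} (hc : 1 / 2 ≤ c) {T : Finset ℕ}
    (hT : T ⊆ Finset.Icc 1 N) :
    ∑ d ∈ T, (∏ p ∈ d.primeFactors, (r.gcd (p - 1) : ℝ)) * (d : ℝ) ^ (-(1 + c)) ≤
      Real.exp (4 * ∑ p ∈ Finset.Icc 2 N, (r.gcd (p - 1) : ℝ) * (p : ℝ) ^ (-(1 + c))) := by
  refine (sum_le_exp_sum_primes (s := Finset.Icc 2 N)
    (f := fun d => (∏ p ∈ d.primeFactors, (r.gcd (p - 1) : ℝ)) * (d : ℝ) ^ (-(1 + c)))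
    (g := fun p => (r.gcd (p - 1) : ℝ) * (p : ℝ) ^ (-(1 + c)))
    (fun n => by positivity) (by simp) (fun {m n} hmn => ?_) (fun p hp e => ?_)
    fun d hd => ?_).trans ?_
  · rw [hmn.primeFactors_mul, Finset.prod_union hmn.disjoint_primeFactors, Nat.cast_mul,
      Real.mul_rpow (by positivity) (by positivity)]
    ring
  · rw [Nat.primeFactors_prime_pow e.succ_ne_zero hp, Finset.prod_singleton, mul_assoc,
      Nat.cast_pow, ← Real.rpow_natCast, ← Real.rpow_mul (by positivity),
      mul_comm ((e + 1 : ℕ) : ℝ), Real.rpow_mul (by positivity), Real.rpow_natCast, pow_succ']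
    gcongr
    exact prime_rpow_neg_le hp (by linarith)
  · have hd' := Finset.mem_Icc.mp (hT hd)
    refine Nat.mem_factoredNumbers_of_primeFactors_subset (by omega) fun p hp => ?_
    exact Finset.mem_Icc.mpr ⟨(Nat.prime_of_mem_primeFactors hp).two_le,
      (Nat.le_of_mem_primeFactors hp).trans hd'.2⟩
  · gcongr
    exact Finset.filter_subset _ _

/-- Primality of `p` is dropped: for each `h ∣ r` write `p = h * j + 1`, so that `h * p ^ (-(1 + c))
≤ h ^ (-c) * j ^ (-(1 + c))`, and the sum over `j` converges uniformly since `1 + c ≥ 3/2`. -/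
theorem sum_gcd_mul_rpow_le {r : ℕ} (hr : 0 < r) (N : ℕ) {c : ℝ} (hc : 1 / 2 ≤ c) :
    ∑ p ∈ Finset.Icc 2 N, (r.gcd (p - 1) : ℝ) * (p : ℝ) ^ (-(1 + c)) ≤
      (∑' j : ℕ, (j : ℝ) ^ (-(3 / 2) : ℝ)) * ∑ h ∈ r.divisors, (h : ℝ) ^ (-c) := by
  have hsum : Summable fun j : ℕ => (j : ℝ) ^ (-(3 / 2) : ℝ) :=
    Real.summable_nat_rpow.mpr (by norm_num)
  calc ∑ p ∈ Finset.Icc 2 N, (r.gcd (p - 1) : ℝ) * (p : ℝ) ^ (-(1 + c))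
      ≤ ∑ p ∈ Finset.Icc 2 N, ∑ h ∈ r.divisors,
          (if h ∣ p - 1 then (h : ℝ) * (p : ℝ) ^ (-(1 + c)) else 0) := by
        refine Finset.sum_le_sum fun p _ => ?_
        have hmem : r.gcd (p - 1) ∈ r.divisors :=
          Nat.mem_divisors.mpr ⟨Nat.gcd_dvd_left _ _, hr.ne'⟩
        refine le_trans ?_ (Finset.single_le_sum (fun h _ => ?_) hmem)
        · rw [if_pos (Nat.gcd_dvd_right _ _)]
        · split_ifs <;> positivity
    _ = ∑ h ∈ r.divisors, ∑ p ∈ Finset.Icc 2 N,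
          (if h ∣ p - 1 then (h : ℝ) * (p : ℝ) ^ (-(1 + c)) else 0) := Finset.sum_comm
    _ ≤ ∑ h ∈ r.divisors, (∑' j : ℕ, (j : ℝ) ^ (-(3 / 2) : ℝ)) * (h : ℝ) ^ (-c) := by
        refine Finset.sum_le_sum fun h hh => ?_
        have hh0 : 0 < h := Nat.pos_of_mem_divisors hh
        have hh0' : (0 : ℝ) < h := by exact_mod_cast hh0
        rw [← Finset.sum_filter]
        calc ∑ p ∈ (Finset.Icc 2 N).filter (fun p => h ∣ p - 1), (h : ℝ) * (p : ℝ) ^ (-(1 + c))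
            ≤ ∑ j ∈ Finset.Icc 1 N, (j : ℝ) ^ (-(3 / 2) : ℝ) * (h : ℝ) ^ (-c) := by
              refine sum_le_sum_of_exists (fun j => h * j + 1) (fun _ _ => by positivity) ?_
              intro p hp
              simp only [Finset.mem_filter, Finset.mem_Icc] at hp
              obtain ⟨⟨hp2, hpN⟩, j, hj⟩ := hp
              have hj0 : 0 < j := by
                rcases Nat.eq_zero_or_pos j with rfl | h
                · omega
                · exact h
              have hjp : j ≤ p - 1 := by rw [hj]; exact Nat.le_mul_of_pos_left _ hh0
              have hj1 : (1 : ℝ) ≤ j := by exact_mod_cast hj0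
              refine ⟨j, Finset.mem_Icc.mpr ⟨hj0, by omega⟩, by omega, ?_⟩
              have hhj : (0 : ℝ) < h * j := by positivity
              have hle : (h : ℝ) * j ≤ p := by
                exact_mod_cast (by omega : h * j ≤ p)
              calc (h : ℝ) * (p : ℝ) ^ (-(1 + c)) ≤ h * ((h : ℝ) * j) ^ (-(1 + c)) := by
                    refine mul_le_mul_of_nonneg_left ?_ hh0'.le
                    exact Real.rpow_le_rpow_of_nonpos hhj hle (by linarith)
                _ = (j : ℝ) ^ (-(1 + c)) * (h : ℝ) ^ (-c) := by
                    rw [Real.mul_rpow (by positivity) (by positivity), neg_add,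
                      Real.rpow_add hh0', Real.rpow_neg_one]
                    field_simp
                _ ≤ _ := by
                    gcongr
                    linarith
          _ = (∑ j ∈ Finset.Icc 1 N, (j : ℝ) ^ (-(3 / 2) : ℝ)) * (h : ℝ) ^ (-c) := by
              rw [Finset.sum_mul]
          _ ≤ _ := by
              gcongr
              exact hsum.sum_le_tsum _ fun _ _ => by positivity
    _ = _ := by rw [Finset.mul_sum]

/-- Rankin's trick: `1 / d < P² / N` on the range of summation, so `1 - c` of the two powers of `1 /
d` are traded for a power of `P² / N`, leaving a sum controlled by an Euler product. -/
theorem sum_rootCount_div_sq_le {N P r : ℕ} (hP : 0 < P) (hN : 0 < N) (hr : 0 < r) {c : ℝ}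
    (hc : 1 / 2 ≤ c) (hc1 : c ≤ 1) :
    ∑ d ∈ (Finset.Icc 1 N).filter (fun d => r.Coprime d ∧ N < d * P ^ 2),
        (rootCount d r : ℝ) / (d : ℝ) ^ 2 ≤
      ((P : ℝ) ^ 2 / N) ^ (1 - c) * Real.exp (4 * ((∑' j : ℕ, (j : ℝ) ^ (-(3 / 2) : ℝ)) *
        Real.exp (4 * ∑ p ∈ r.primeFactors, (p : ℝ) ^ (-c)))) := by
  set T := (Finset.Icc 1 N).filter (fun d => r.Coprime d ∧ N < d * P ^ 2) with hT
  calc ∑ d ∈ T, (rootCount d r : ℝ) / (d : ℝ) ^ 2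
      ≤ ∑ d ∈ T, ((P : ℝ) ^ 2 / N) ^ (1 - c) *
          ((∏ p ∈ d.primeFactors, (r.gcd (p - 1) : ℝ)) * (d : ℝ) ^ (-(1 + c))) := by
        refine Finset.sum_le_sum fun d hd => ?_
        simp only [hT, Finset.mem_filter, Finset.mem_Icc] at hd
        obtain ⟨⟨hd1, -⟩, hcop, hlt⟩ := hd
        have hd0 : (0 : ℝ) < d := by exact_mod_cast hd1
        have hN0 : (0 : ℝ) < N := by exact_mod_cast hN
        have h1 : (rootCount d r : ℝ) ≤ ∏ p ∈ d.primeFactors, (r.gcd (p - 1) : ℝ) := by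
          exact_mod_cast rootCount_le_prod (by omega) hr hcop
        have h2 : (d : ℝ)⁻¹ ≤ (P : ℝ) ^ 2 / N := by
          rw [inv_eq_one_div, div_le_div_iff₀ hd0 hN0, one_mul, mul_comm]
          exact_mod_cast hlt.le
        have h3 : (((d : ℝ) ^ 2)⁻¹) = (d : ℝ)⁻¹ ^ (1 - c) * (d : ℝ) ^ (-(1 + c)) := by
          rw [Real.inv_rpow hd0.le, ← Real.rpow_neg hd0.le, ← Real.rpow_add hd0,
            ← Real.rpow_natCast, ← Real.rpow_neg hd0.le]
          congr 1
          push_cast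
          ring
        rw [div_eq_mul_inv, h3]
        calc (rootCount d r : ℝ) * ((d : ℝ)⁻¹ ^ (1 - c) * (d : ℝ) ^ (-(1 + c)))
            ≤ (∏ p ∈ d.primeFactors, (r.gcd (p - 1) : ℝ)) *
              (((P : ℝ) ^ 2 / N) ^ (1 - c) * (d : ℝ) ^ (-(1 + c))) := by
              gcongr
          _ = _ := by ring
    _ ≤ _ := by
        rw [← Finset.mul_sum]
        gcongr
        refine (sum_prod_gcd_mul_rpow_le r hc (Finset.filter_subset _ _)).trans ?_
        gcongr
        refine (sum_gcd_mul_rpow_le hr N hc).trans ?_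
        gcongr
        exact sum_divisors_rpow_neg_le r hc

/-! ### Sums over primes -/

/-- Chebyshev's bound `θ(z) ≤ z log 4` on a dyadic block; summing over blocks gives a Mertens-type
upper bound, with constant 4 in place of 1. -/
theorem sum_prime_inv_dyadic_le {K : ℕ} (hK : 0 < K) :
    ∑ p ∈ (Finset.Ioc (2 ^ K) (2 ^ (K + 1))).filter Nat.Prime, (p : ℝ)⁻¹ ≤ 4 / K := by
  have hlog2 : 0 < Real.log 2 := Real.log_pos (by norm_num)
  have hK0 : (0 : ℝ) < K := by exact_mod_cast hK
  have hpt : ∀ p ∈ (Finset.Ioc (2 ^ K) (2 ^ (K + 1))).filter Nat.Prime,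
      (p : ℝ)⁻¹ ≤ (2 ^ K * (K * Real.log 2))⁻¹ * Real.log p := by
    intro p hp
    simp only [Finset.mem_filter, Finset.mem_Ioc] at hp
    have h1 : (2 : ℝ) ^ K ≤ p := by exact_mod_cast hp.1.1.le
    have hp0 : (0 : ℝ) < p := lt_of_lt_of_le (by positivity) h1
    have h2 : K * Real.log 2 ≤ Real.log p := by
      rw [← Real.log_pow]
      exact Real.log_le_log (by positivity) h1
    rw [inv_mul_eq_div, inv_eq_one_div, div_le_div_iff₀ hp0 (by positivity), one_mul, mul_comm]
    gcongr
  have htheta : ∑ p ∈ (Finset.Ioc (2 ^ K) (2 ^ (K + 1))).filter Nat.Prime, Real.log p ≤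
      Real.log 4 * 2 ^ (K + 1) := by
    refine le_trans ?_ (Chebyshev.theta_le_log4_mul_x (x := (2 : ℝ) ^ (K + 1)) (by positivity))
    rw [Chebyshev.theta]
    have hfl : ⌊(2 : ℝ) ^ (K + 1)⌋₊ = 2 ^ (K + 1) := by
      exact_mod_cast Nat.floor_natCast (R := ℝ) (2 ^ (K + 1))
    rw [hfl]
    refine Finset.sum_le_sum_of_subset_of_nonneg ?_ fun p _ _ => Real.log_natCast_nonneg p
    exact Finset.filter_subset_filter _ (Finset.Ioc_subset_Ioc_left (Nat.zero_le _))
  have hlog4 : Real.log 4 = 2 * Real.log 2 := by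
    rw [show (4 : ℝ) = 2 ^ 2 by norm_num, Real.log_pow]
    norm_num
  calc _ ≤ ∑ p ∈ (Finset.Ioc (2 ^ K) (2 ^ (K + 1))).filter Nat.Prime,
          (2 ^ K * (K * Real.log 2))⁻¹ * Real.log p := Finset.sum_le_sum hpt
    _ ≤ (2 ^ K * (K * Real.log 2))⁻¹ * (Real.log 4 * 2 ^ (K + 1)) := by
        rw [← Finset.mul_sum]
        gcongr
    _ = 4 / K := by
        rw [hlog4, pow_succ]
        field_simp
        norm_num

theorem sum_prime_inv_two_pow_le (K : ℕ) :
    ∑ p ∈ (Finset.Icc 1 (2 ^ (K + 1))).filter Nat.Prime, (p : ℝ)⁻¹ ≤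
      1 + 4 * ∑ k ∈ Finset.Icc 1 K, (1 / k : ℝ) := by
  induction K with
  | zero =>
    have : (Finset.Icc 1 (2 ^ (0 + 1))).filter Nat.Prime = {2} := by decide
    rw [this]
    norm_num
  | succ K ih =>
    have hun : (Finset.Icc 1 (2 ^ (K + 1 + 1))).filter Nat.Prime =
        (Finset.Icc 1 (2 ^ (K + 1))).filter Nat.Prime ∪
          (Finset.Ioc (2 ^ (K + 1)) (2 ^ (K + 1 + 1))).filter Nat.Prime := by
      have h2 : 2 ^ (K + 1) ≤ 2 ^ (K + 1 + 1) := Nat.pow_le_pow_right (by norm_num) (by omega)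
      ext p
      simp only [Finset.mem_union, Finset.mem_filter, Finset.mem_Icc, Finset.mem_Ioc]
      constructor
      · rintro ⟨h, hp⟩
        by_cases h3 : p ≤ 2 ^ (K + 1)
        · exact Or.inl ⟨⟨h.1, h3⟩, hp⟩
        · exact Or.inr ⟨⟨by omega, h.2⟩, hp⟩
      · rintro (⟨h, hp⟩ | ⟨h, hp⟩)
        · exact ⟨⟨h.1, h.2.trans h2⟩, hp⟩
        · exact ⟨⟨hp.one_le, h.2⟩, hp⟩
    have hdisj : Disjoint ((Finset.Icc 1 (2 ^ (K + 1))).filter Nat.Prime)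
        ((Finset.Ioc (2 ^ (K + 1)) (2 ^ (K + 1 + 1))).filter Nat.Prime) := by
      rw [Finset.disjoint_left]
      intro p hp hq
      simp only [Finset.mem_filter, Finset.mem_Icc, Finset.mem_Ioc] at hp hq
      omega
    rw [hun, Finset.sum_union hdisj, Finset.sum_Icc_succ_top (by omega)]
    have := sum_prime_inv_dyadic_le (K := K + 1) (by omega)
    rw [mul_add, ← add_assoc, mul_one_div]
    exact add_le_add ih this

theorem sum_prime_inv_le {y : ℝ} (hy : 1 < y) :
    ∑ p ∈ (Finset.Icc 1 ⌊y⌋₊).filter Nat.Prime, (p : ℝ)⁻¹ ≤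
      5 + 4 * Real.log (2 * Real.log y + 1) := by
  have hlogy : 0 < Real.log y := Real.log_pos hy
  have hlog2 : 0 < Real.log 2 := Real.log_pos (by norm_num)
  set K := ⌈Real.log y / Real.log 2⌉₊ with hK
  have hK0 : 0 < K := Nat.ceil_pos.mpr (by positivity)
  have hKle : (K : ℝ) ≤ 2 * Real.log y + 1 := by
    refine (Nat.ceil_lt_add_one (by positivity)).le.trans ?_
    gcongr
    rw [div_le_iff₀ hlog2]
    nlinarith [Real.log_two_gt_d9]
  have hyK : y ≤ (2 : ℝ) ^ (K + 1) := by
    rw [← Real.log_le_log_iff (by linarith) (by positivity), Real.log_pow]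
    have h1 : Real.log y / Real.log 2 ≤ K := Nat.le_ceil _
    rw [div_le_iff₀ hlog2] at h1
    push_cast
    nlinarith
  have hfl : ⌊y⌋₊ ≤ 2 ^ (K + 1) := Nat.floor_le_of_le (by exact_mod_cast hyK)
  calc _ ≤ ∑ p ∈ (Finset.Icc 1 (2 ^ (K + 1))).filter Nat.Prime, (p : ℝ)⁻¹ :=
        Finset.sum_le_sum_of_subset_of_nonneg
          (Finset.filter_subset_filter _ (Finset.Icc_subset_Icc_right hfl))
          fun _ _ _ => by positivity
    _ ≤ 1 + 4 * (1 + Real.log K) := (sum_prime_inv_two_pow_le K).trans (by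
        gcongr
        exact sum_inv_Icc_le_one_add_log K)
    _ = 5 + 4 * Real.log K := by ring
    _ ≤ _ := by gcongr

theorem card_primeFactors_le_two_mul_log {r : ℕ} (hr : 0 < r) :
    (r.primeFactors.card : ℝ) ≤ 2 * Real.log r := by
  have h1 : 2 ^ r.primeFactors.card ≤ r :=
    (Finset.pow_card_le_prod _ (fun p => p) 2
      fun p hp => (Nat.prime_of_mem_primeFactors hp).two_le).trans
      (Nat.le_of_dvd hr (Nat.prod_primeFactors_dvd r))
  have h2 : r.primeFactors.card * Real.log 2 ≤ Real.log r := by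
    rw [← Real.log_pow]
    exact Real.log_le_log (by positivity) (by exact_mod_cast h1)
  nlinarith [Real.log_two_gt_d9, Real.log_natCast_nonneg r]

/-- Split at `y`: below it `p ^ (-c) ≤ y ^ (1 - c) / p`, above it `p ^ (-c) ≤ y ^ (1 - c) / y`. The
large primes number at most `2 log r ≤ 2y`, which turns the 5 of `sum_prime_inv_le` into 7. -/
theorem sum_primeFactors_rpow_neg_le {r : ℕ} (hr : 0 < r) {y c : ℝ} (hy : 1 < y)
    (hry : Real.log r ≤ y) (hc0 : 0 ≤ c) (hc1 : c ≤ 1) :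
    ∑ p ∈ r.primeFactors, (p : ℝ) ^ (-c) ≤
      y ^ (1 - c) * (7 + 4 * Real.log (2 * Real.log y + 1)) := by
  have hy0 : 0 < y := by linarith
  have hpt : ∀ p ∈ r.primeFactors,
      (p : ℝ) ^ (-c) ≤ y ^ (1 - c) * ((if (p : ℝ) ≤ y then (p : ℝ)⁻¹ else 0) + y⁻¹) := by
    intro p hp
    have hp0 : (0 : ℝ) < p := by exact_mod_cast (Nat.prime_of_mem_primeFactors hp).pos
    split_ifs with h
    · calc (p : ℝ) ^ (-c) = (p : ℝ) ^ (1 - c) * (p : ℝ)⁻¹ := by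
            rw [← Real.rpow_neg_one, ← Real.rpow_add hp0]
            ring_nf
        _ ≤ y ^ (1 - c) * ((p : ℝ)⁻¹ + y⁻¹) := by
            have : 0 ≤ y⁻¹ := by positivity
            gcongr
            · linarith
    · calc (p : ℝ) ^ (-c) ≤ y ^ (-c) :=
            Real.rpow_le_rpow_of_nonpos hy0 (not_le.mp h).le (by linarith)
        _ = y ^ (1 - c) * y⁻¹ := by
            rw [← Real.rpow_neg_one, ← Real.rpow_add hy0]
            ring_nf
        _ = _ := by rw [zero_add]
  refine (Finset.sum_le_sum hpt).trans ?_
  rw [← Finset.mul_sum, Finset.sum_add_distrib, ← Finset.sum_filter, Finset.sum_const, nsmul_eq_mul]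
  have h1 : ∑ p ∈ r.primeFactors.filter (fun p : ℕ => (p : ℝ) ≤ y), (p : ℝ)⁻¹ ≤
      5 + 4 * Real.log (2 * Real.log y + 1) := by
    refine le_trans (Finset.sum_le_sum_of_subset_of_nonneg ?_ fun _ _ _ => by positivity)
      (sum_prime_inv_le hy)
    intro p hp
    rw [Finset.mem_filter] at hp
    have hpp := Nat.prime_of_mem_primeFactors hp.1
    exact Finset.mem_filter.mpr
      ⟨Finset.mem_Icc.mpr ⟨hpp.one_le, Nat.le_floor hp.2⟩, hpp⟩
  have h2 : (r.primeFactors.card : ℝ) * y⁻¹ ≤ 2 := by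
    rw [← div_eq_mul_inv, div_le_iff₀ hy0]
    linarith [card_primeFactors_le_two_mul_log hr]
  exact mul_le_mul_of_nonneg_left (by linarith) (by positivity)

/-! ### Choice of parameters and asymptotics -/

/-- Used with `t = log log x`; the bound `t / 2` makes the inner exponential at most `√(log x)`. -/
theorem eventually_rpow_mul_log_le {ε : ℝ} (hε : 0 < ε) :
    ∀ᶠ t : ℝ in atTop, 4 * (t ^ (1 - ε) * (7 + 4 * Real.log (2 * t + 1))) ≤ t / 2 := by
  have h1 := (isLittleO_log_rpow_atTop hε).bound (c := 1 / 64) (by norm_num)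
  have h2 := (tendsto_rpow_atTop hε).eventually_ge_atTop (8 * (28 + 16 * Real.log 3))
  filter_upwards [h1, h2, eventually_ge_atTop 1] with t h1 h2 ht
  have ht0 : 0 < t := by linarith
  rw [Real.norm_of_nonneg (Real.log_nonneg ht), Real.norm_of_nonneg (by positivity)] at h1
  have h3 : Real.log (2 * t + 1) ≤ Real.log 3 + Real.log t := by
    rw [← Real.log_mul (by norm_num) ht0.ne']
    exact Real.log_le_log (by linarith) (by linarith)
  have h4 : 4 * (7 + 4 * Real.log (2 * t + 1)) ≤ t ^ ε / 2 := by
    linarith [Real.rpow_nonneg ht0.le ε]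
  calc 4 * (t ^ (1 - ε) * (7 + 4 * Real.log (2 * t + 1)))
      = t ^ (1 - ε) * (4 * (7 + 4 * Real.log (2 * t + 1))) := by ring
    _ ≤ t ^ (1 - ε) * (t ^ ε / 2) := by gcongr
    _ = t / 2 := by
        rw [← mul_div_assoc, ← Real.rpow_add ht0, sub_add_cancel, Real.rpow_one]

theorem eventually_sqrt_mul_log_le {C ε : ℝ} (hC : 0 ≤ C) (hε : 0 < ε) :
    ∀ᶠ l : ℝ in atTop, (5 + Real.log (3 + l) + C * √l) * Real.log l ≤ ε * l := by
  have h1 := (isLittleO_log_rpow_atTop (r := 1 / 2) (by norm_num)).bound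
    (c := ε / (9 + C)) (by positivity)
  filter_upwards [h1, eventually_ge_atTop 1] with l h1 hl
  have hlog := Real.log_nonneg hl
  rw [Real.norm_of_nonneg hlog, Real.norm_of_nonneg (by positivity), ← Real.sqrt_eq_rpow,
    div_mul_eq_mul_div, le_div_iff₀ (by positivity)] at h1
  have hsq : 1 ≤ √l := Real.one_le_sqrt.mpr hl
  have h2 : Real.log (3 + l) ≤ 4 * √l := by
    have h3 : √(3 + l) ≤ 2 * √l := by
      rw [show (2 : ℝ) = √4 by rw [show (4 : ℝ) = 2 ^ 2 by norm_num]; simp,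
        ← Real.sqrt_mul (by norm_num)]
      exact Real.sqrt_le_sqrt (by linarith)
    have h4 := Real.log_le_self (Real.sqrt_nonneg (3 + l))
    rw [Real.log_sqrt (by linarith)] at h4
    linarith
  calc (5 + Real.log (3 + l) + C * √l) * Real.log l ≤ ((9 + C) * √l) * Real.log l := by
        gcongr
        nlinarith
    _ = √l * (Real.log l * (9 + C)) := by ring
    _ ≤ √l * (ε * √l) := by gcongr
    _ = ε * l := by
        rw [mul_left_comm, Real.mul_self_sqrt (by linarith)]

/-- Rounding costs a factor 8 in `P² / N ≤ 8 exp (2lu) / x`, and `v * log 8 ≤ 3`. -/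
theorem rpow_ceil_sq_div_floor_le {x l u v : ℝ} (hx : x = Real.exp l) (hl : 1 ≤ l) (hu0 : 0 ≤ u)
    (hv0 : 0 ≤ v) (hvu : v ≤ u) (hu1 : u ≤ 1) :
    ((⌈Real.exp (l * u)⌉₊ : ℝ) ^ 2 / ⌊x⌋₊) ^ v ≤ Real.exp (3 + 2 * l * u ^ 2 - v * l) := by
  have hx2 : 2 ≤ x := by rw [hx]; linarith [Real.add_one_le_exp l]
  have hL1 : 1 ≤ Real.exp (l * u) := Real.one_le_exp (by positivity)
  have hP : (⌈Real.exp (l * u)⌉₊ : ℝ) ≤ 2 * Real.exp (l * u) := by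
    linarith [Nat.ceil_lt_add_one (Real.exp_pos (l * u)).le]
  have hN : x / 2 ≤ ⌊x⌋₊ := by linarith [Nat.lt_floor_add_one x]
  have hlog8 : Real.log 8 ≤ 3 := by
    rw [show (8 : ℝ) = 2 ^ 3 by norm_num, Real.log_pow]
    norm_num
    linarith [Real.log_two_lt_d9]
  have h1 : (⌈Real.exp (l * u)⌉₊ : ℝ) ^ 2 / ⌊x⌋₊ ≤ Real.exp (Real.log 8 + 2 * (l * u) - l) := by
    calc (⌈Real.exp (l * u)⌉₊ : ℝ) ^ 2 / ⌊x⌋₊ ≤ (2 * Real.exp (l * u)) ^ 2 / (x / 2) := by gcongr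
      _ = _ := by
          rw [Real.exp_sub, Real.exp_add, Real.exp_log (by norm_num), two_mul (l * u),
            Real.exp_add, hx]
          field_simp
          norm_num
  refine (Real.rpow_le_rpow (by positivity) h1 hv0).trans ?_
  rw [← Real.exp_mul]
  apply Real.exp_le_exp.mpr
  have h2 : v * Real.log 8 ≤ 1 * 3 := by gcongr; linarith
  have h3 : v * (2 * (l * u)) ≤ u * (2 * (l * u)) := by gcongr
  nlinarith

theorem eventually_sum_rootCount_composite_le {ε : ℝ} (hε : 0 < ε) (hε1 : ε < 1) :
    ∀ᶠ x : ℝ in atTop, ∑ n ∈ (Finset.Icc 1 ⌊x⌋₊).filter IsComposite, (rootCount n (n - 1) : ℝ) ≤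
      x ^ 2 * scriptL x ^ (-1 + 2 * ε) := by
  set C : ℝ := ∑' j : ℕ, (j : ℝ) ^ (-(3 / 2) : ℝ) with hC
  have hC0 : 0 ≤ C := tsum_nonneg fun _ => by positivity
  have hlog := Real.tendsto_log_atTop
  have hlog2 := hlog.comp hlog
  have hlog3 := hlog.comp hlog2
  have hratio : ∀ᶠ t : ℝ in atTop, Real.log t ≤ ε / 8 * t := by
    have := Real.isLittleO_log_id_atTop.bound (c := ε / 8) (by positivity)
    filter_upwards [this, eventually_ge_atTop 1] with t h ht
    rwa [Real.norm_of_nonneg (Real.log_nonneg ht), id, Real.norm_of_nonneg (by linarith)] at h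
  filter_upwards [hlog3.eventually_ge_atTop 1, hlog2.eventually hratio,
    hlog2.eventually (eventually_rpow_mul_log_le hε),
    hlog.eventually (eventually_sqrt_mul_log_le (C := 4 * C) (by positivity) (half_pos hε)),
    hlog2.eventually_ge_atTop 1, hlog.eventually_ge_atTop 3,
    eventually_gt_atTop 0] with x hs hu hA hB ht1 hl3 hx0
  simp only [Function.comp_apply] at hs hu hA ht1
  have hL : scriptL x = Real.exp (Real.log x *
      (Real.log (Real.log (Real.log x)) / Real.log (Real.log x))) := by
    rw [scriptL, mul_div_assoc]
  have hxl : x = Real.exp (Real.log x) := (Real.exp_log hx0).symm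
  set l := Real.log x with hl
  set t := Real.log l with ht
  set s := Real.log t with hsdef
  set u := s / t with hudef
  have ht0 : 0 < t := by linarith
  have hl0 : 0 < l := by linarith
  have hu0 : 0 ≤ u := by positivity
  have huε : u ≤ ε / 8 := by rwa [hudef, div_le_iff₀ ht0]
  have hut : 1 ≤ u * t := by rwa [hudef, div_mul_cancel₀ _ ht0.ne']
  have hlu0 : 0 ≤ l * u := by positivity
  -- Here `l * u = log 𝓛(x)`. As `u * t = log log log x ≥ 1`, it is at least `l / log l`, which
  -- dominates `√l`.
  have hB' : 5 + Real.log (3 + l) + 4 * C * √l ≤ ε / 2 * (l * u) := by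
    have h1 : 0 ≤ Real.log (3 + l) := Real.log_nonneg (by linarith)
    have h2 : 0 ≤ 5 + Real.log (3 + l) + 4 * C * √l := by positivity
    calc _ ≤ (5 + Real.log (3 + l) + 4 * C * √l) * (u * t) := le_mul_of_one_le_right h2 hut
      _ = ((5 + Real.log (3 + l) + 4 * C * √l) * t) * u := by ring
      _ ≤ (ε / 2 * l) * u := by gcongr
      _ = _ := by ring
  -- Rankin's exponent is `c = 1 - v`. This `v` makes `l ^ v = exp (t * v) = t ^ (1 - ε)`, just
  -- small enough for the prime sum to be `o(t)`.
  set v := (1 - ε) * u with hv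
  have hv0 : 0 ≤ v := mul_nonneg (by linarith) hu0
  have hvu : v ≤ u := mul_le_of_le_one_left hu0 (by linarith)
  set N := ⌊x⌋₊ with hN
  set P := ⌈Real.exp (l * u)⌉₊ with hP
  have hP0 : 0 < P := Nat.ceil_pos.mpr (Real.exp_pos _)
  have hPN : P ≤ N := by
    refine Nat.le_floor ((Nat.ceil_lt_add_one (Real.exp_pos _).le).le.trans ?_)
    have h1 : Real.exp (l * u) ≤ Real.exp (l / 8) := Real.exp_le_exp.mpr (by nlinarith)
    have h2 : x = Real.exp (l / 8) * Real.exp (7 * l / 8) := by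
      rw [← Real.exp_add]
      convert hxl using 2
      ring
    have h3 := Real.add_one_le_exp (7 * l / 8)
    have h4 : 1 ≤ Real.exp (l / 8) := Real.one_le_exp (by linarith)
    nlinarith
  have hN0 : 0 < N := hP0.trans_le hPN
  have hNx : (N : ℝ) ≤ x := Nat.floor_le hx0.le
  have hlogN : Real.log N ≤ l := Real.log_le_log (by exact_mod_cast hN0) hNx
  have hsqrt : Real.exp (t / 2) = √l := by
    rw [Real.sqrt_eq_rpow, Real.rpow_def_of_pos hl0, ← ht]
    ring_nf
  have hinner : ∀ r ∈ Finset.Icc 1 N,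
      ∑ d ∈ (Finset.Icc 1 N).filter (fun d => r.Coprime d ∧ N < d * P ^ 2),
        (rootCount d r : ℝ) / (d : ℝ) ^ 2 ≤
      Real.exp (3 + 2 * l * u ^ 2 - v * l) * Real.exp (4 * (C * √l)) := by
    intro r hr
    rw [Finset.mem_Icc] at hr
    have hlogr : Real.log r ≤ l :=
      (Real.log_le_log (by exact_mod_cast hr.1) (by exact_mod_cast hr.2)).trans hlogN
    have h1 := sum_rootCount_div_sq_le (P := P) hP0 hN0 hr.1 (c := 1 - v) (by linarith)
      (by linarith)
    have h2 := sum_primeFactors_rpow_neg_le hr.1 (by linarith : 1 < l) hlogr (c := 1 - v)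
      (by linarith) (by linarith)
    rw [sub_sub_cancel] at h1 h2
    have h3 : l ^ v = t ^ (1 - ε) := by
      rw [Real.rpow_def_of_pos hl0, Real.rpow_def_of_pos ht0, hv, ← ht, ← hsdef, hudef]
      congr 1
      field_simp
    rw [h3] at h2
    have h4 : Real.exp (4 * ∑ p ∈ r.primeFactors, (p : ℝ) ^ (-(1 - v))) ≤ √l := by
      rw [← hsqrt]
      apply Real.exp_le_exp.mpr
      linarith
    refine h1.trans ?_
    gcongr
    exact rpow_ceil_sq_div_floor_le hxl (by linarith) hu0 hv0 hvu (by linarith)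
  have hPL : Real.exp (l * u) ≤ P := Nat.le_ceil _
  have hmain := sum_rootCount_composite_le hP0 hPN
  set E := Real.exp ((-1 + 2 * ε) * (l * u)) with hE
  have hLE : scriptL x ^ (-1 + 2 * ε) = E := by rw [hL, ← Real.exp_mul, mul_comm, hE]
  -- The spare `-1` in the exponent gives `exp (-1) ≤ 1/2`, so the two main terms add up to `E`.
  have hexp1 : ∀ z : ℝ, z ≤ (-1 + 2 * ε) * (l * u) - 1 → Real.exp z ≤ E / 2 := by
    intro z hz
    have h1 : Real.exp (-1) ≤ 1 / 2 := by
      rw [Real.exp_neg, inv_le_comm₀ (Real.exp_pos 1) (by norm_num)]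
      linarith [Real.exp_one_gt_d9]
    calc Real.exp z ≤ Real.exp ((-1 + 2 * ε) * (l * u) + (-1)) := Real.exp_le_exp.mpr hz
      _ = E * Real.exp (-1) := by rw [Real.exp_add]
      _ ≤ E * (1 / 2) := by gcongr
      _ = E / 2 := by ring
  clear_value E P N C v u s t l
  have h3l : 0 < 3 + l := by linarith
  have hsq0 : 0 ≤ 4 * C * √l := by positivity
  have hlog3l : 0 ≤ Real.log (3 + l) := Real.log_nonneg (by linarith)
  have hεlu : 0 ≤ ε * (l * u) := by positivity
  have hfirst : (N : ℝ) ^ 2 / P * (3 + Real.log N) ≤ x ^ 2 * (E / 2) := by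
    calc (N : ℝ) ^ 2 / P * (3 + Real.log N) ≤ x ^ 2 / Real.exp (l * u) * (3 + l) := by
          gcongr
      _ = x ^ 2 * Real.exp (Real.log (3 + l) - l * u) := by
          rw [Real.exp_sub, Real.exp_log h3l]
          ring
      _ ≤ x ^ 2 * (E / 2) := by
          gcongr
          apply hexp1
          linarith
  have hsecond : (N : ℝ) ^ 2 * ∑ r ∈ Finset.Icc 1 N, 1 / (r : ℝ) *
        ∑ d ∈ (Finset.Icc 1 N).filter (fun d => r.Coprime d ∧ N < d * P ^ 2),
          (rootCount d r : ℝ) / (d : ℝ) ^ 2 ≤ x ^ 2 * (E / 2) := by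
    calc _ ≤ x ^ 2 * ∑ r ∈ Finset.Icc 1 N, 1 / (r : ℝ) *
          (Real.exp (3 + 2 * l * u ^ 2 - v * l) * Real.exp (4 * (C * √l))) := by
          gcongr with r hr
          exact hinner r hr
      _ ≤ x ^ 2 * ((3 + l) *
          (Real.exp (3 + 2 * l * u ^ 2 - v * l) * Real.exp (4 * (C * √l)))) := by
          rw [← Finset.sum_mul]
          gcongr
          linarith [sum_inv_Icc_le_one_add_log N]
      _ = x ^ 2 * Real.exp (Real.log (3 + l) + (3 + 2 * l * u ^ 2 - v * l) + 4 * (C * √l)) := by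
          rw [Real.exp_add, Real.exp_add, Real.exp_log h3l]
          ring
      _ ≤ x ^ 2 * (E / 2) := by
          gcongr
          apply hexp1
          have h1 : l * u * u ≤ l * u * (ε / 8) := by gcongr
          have h2 : v * l = (1 - ε) * (l * u) := by rw [hv]; ring
          rw [h2]
          linarith
  rw [hLE]
  linarith

/-! ### Extracting the `o(1)` and conclusion -/

/-- Solve for the exponent: `L ^ (-1 + o) = R`. Taking the maximum with `L⁻¹` keeps `R` positive and
`o` nonnegative even where `S` is tiny or nonpositive. -/
theorem exists_tendsto_zero_of_forall_eventually_le {S : ℝ → ℝ} {L : ℝ → ℝ}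
    (hL : ∀ᶠ x in atTop, 1 < L x)
    (h : ∀ ε : ℝ, 0 < ε → ∀ᶠ x in atTop, S x ≤ x ^ 3 * L x ^ (-1 + ε)) :
    ∃ o : ℝ → ℝ, Tendsto o atTop (𝓝 0) ∧ ∀ᶠ x in atTop, S x ≤ x ^ 3 * L x ^ (-1 + o x) := by
  let R : ℝ → ℝ := fun x => max (S x / x ^ 3) (L x)⁻¹
  let o : ℝ → ℝ := fun x => 1 + Real.log (R x) / Real.log (L x)
  have hR : ∀ᶠ x in atTop, 0 < R x := by
    filter_upwards [hL] with x hx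
    exact lt_max_of_lt_right (inv_pos.mpr (by linarith))
  refine ⟨o, ?_, ?_⟩
  · rw [Metric.tendsto_nhds]
    intro ε hε
    filter_upwards [hL, hR, h (ε / 2) (half_pos hε), eventually_gt_atTop 0] with x hx hRx hS hx0
    have hlogL : 0 < Real.log (L x) := Real.log_pos hx
    have hLpos : 0 < L x := by linarith
    have h0 : 0 ≤ o x := by
      have : Real.log (L x)⁻¹ ≤ Real.log (R x) :=
        Real.log_le_log (inv_pos.mpr hLpos) (le_max_right _ _)
      rw [Real.log_inv] at this
      have h1 : -1 ≤ Real.log (R x) / Real.log (L x) := by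
        rw [le_div_iff₀ hlogL]
        linarith
      simp only [o]
      linarith
    have h1 : o x ≤ ε / 2 := by
      have hRle : R x ≤ L x ^ (-1 + ε / 2) := by
        refine max_le ?_ ?_
        · rwa [div_le_iff₀ (by positivity), mul_comm]
        · rw [← Real.rpow_neg_one]
          exact Real.rpow_le_rpow_of_exponent_le hx.le (by linarith)
      have h2 := Real.log_le_log hRx hRle
      rw [Real.log_rpow hLpos, ← div_le_iff₀ hlogL] at h2
      simp only [o]
      linarith
    rw [Real.dist_eq, sub_zero, abs_of_nonneg h0]
    linarith
  · filter_upwards [hL, hR, eventually_gt_atTop 0] with x hx hRx hx0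
    have hlogL : 0 < Real.log (L x) := Real.log_pos hx
    have hLpos : 0 < L x := by linarith
    have h1 : L x ^ (-1 + o x) = R x := by
      simp only [o]
      rw [neg_add_cancel_left, Real.rpow_def_of_pos hLpos, mul_div_cancel₀ _ hlogL.ne',
        Real.exp_log hRx]
    rw [h1, ← div_le_iff₀' (by positivity)]
    exact le_max_left _ _

theorem eventually_one_lt_scriptL : ∀ᶠ x in atTop, 1 < scriptL x := by
  have hlog := Real.tendsto_log_atTop
  have hlog2 := hlog.comp hlog
  have hlog3 := hlog.comp hlog2
  filter_upwards [hlog.eventually_gt_atTop 0, hlog2.eventually_gt_atTop 0,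
    hlog3.eventually_gt_atTop 0] with x h1 h2 h3
  simp only [Function.comp_apply] at h1 h2 h3
  exact Real.one_lt_exp_iff.mpr (by positivity)

theorem sum_L₂_le {x : ℝ} (hx : 0 ≤ x) :
    ((∑ n ∈ (Finset.Icc 1 ⌊x⌋₊).filter IsComposite, L₂ n : ℕ) : ℝ) ≤
      x * ∑ n ∈ (Finset.Icc 1 ⌊x⌋₊).filter IsComposite, (rootCount n (n - 1) : ℝ) := by
  rw [Nat.cast_sum, Finset.mul_sum]
  refine Finset.sum_le_sum fun n hn => ?_
  simp only [Finset.mem_filter, Finset.mem_Icc] at hn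
  have hnx : (n : ℝ) ≤ x := (Nat.cast_le.mpr hn.1.2).trans (Nat.floor_le hx)
  calc (L₂ n : ℝ) ≤ n * rootCount n (n - 1) := by exact_mod_cast L₂_le n hn.1.1
    _ ≤ _ := by gcongr

end FrobeniusLiars

theorem mainTheorem4 :
    ∃ o : ℝ → ℝ, Tendsto o atTop (𝓝 0) ∧
      ∀ᶠ x : ℝ in atTop,
        ((∑ n ∈ (Finset.Icc 1 ⌊x⌋₊).filter FrobeniusLiars.IsComposite,
            FrobeniusLiars.L₂ n : ℕ) : ℝ)
          ≤ x ^ 3 * FrobeniusLiars.scriptL x ^ (-1 + o x) := by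
  refine FrobeniusLiars.exists_tendsto_zero_of_forall_eventually_le
    FrobeniusLiars.eventually_one_lt_scriptL fun ε hε => ?_
  -- The averaged bound loses `2δ` and needs `δ < 1`.
  have hδ : 0 < min (ε / 2) (1 / 2) := by positivity
  filter_upwards [FrobeniusLiars.eventually_sum_rootCount_composite_le hδ
      (by linarith [min_le_right (ε / 2) (1 / 2)]),
    FrobeniusLiars.eventually_one_lt_scriptL, eventually_ge_atTop 0] with x h hL hx
  calc _ ≤ _ := FrobeniusLiars.sum_L₂_le hx
    _ ≤ x * (x ^ 2 * FrobeniusLiars.scriptL x ^ (-1 + 2 * min (ε / 2) (1 / 2))) := by gcongr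
    _ = x ^ 3 * FrobeniusLiars.scriptL x ^ (-1 + 2 * min (ε / 2) (1 / 2)) := by ring
    _ ≤ _ := by
        gcongr
        · exact hL.le
        · linarith [min_le_left (ε / 2) (1 / 2)]
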